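/- Let $a\ge 1$, $n_t=2^a$, $\lambda=2^{a-1}$, $\varepsilon\in\{1,-1\}$, $n_r\ge 0$, and $$\sigma_1=\begin{pmatrix}0&1\\-1&0\end{pmatrix},\quad \sigma_2=\begin{pmatrix}0&j\\ j&0\end{pmatrix},\quad \sigma_3=\begin{pmatrix}1&0\\0&-1\end{pmatrix},\qquad j=\sqrt{-1}.$$ Put $R(\gamma_1)=\varepsilon\, j\,\sigma_3^{\otimes a}$, $R(\gamma_{2k})=I_2^{\otimes (a-k)}\otimes\sigma_1\otimes\sigma_3^{\otimes(k-1)}$ and $R(\gamma_{2k+1})=I_2^{\otimes (a-k)}\otimes\sigma_2\otimes\sigma_3^{\otimes(k-1)}$ for $1\le k\le a$, and $\alpha_i=j\,R(\gamma_{2i})R(\gamma_{2i+1})$ for $1\le i\le a-1$. Let $X_1(s_1,\dots,s_{4\lambda})=\sum_i s_iA_i$ be the rate-1, four-group-decodable Clifford unitary weight design (CUWD) with weight matrices $$A_k=\prod_{i=1}^{a-1}\alpha_i^{k_i}\ (1\le k\le\lambda),\quad A_{\lambda+1}=R(\gamma_1),\quad A_{2\lambda+1}=R(\gamma_{2a+1}),\quad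 A_{3\lambda+1}=R(\gamma_{2a}),\quad A_{l\lambda+k}=A_kA_{l\lambda+1}\ (l=1,2,3),$$ where $k_1k_2\cdots k_{a-1}$ are the binary digits of $k-1$, most significant first. Let $M\in\mathbb C^{n_t\times n_t}$ and let $$X(s_1,\dots,s_{8\lambda})=X_1(s_1,\dots,s_{4\lambda})+M\,X_1(s_{4\lambda+1},\dots,s_{8\lambda})$$ be the code with the weight matrices $A_1,\dots,A_{4\lambda},MA_1,\dots,MA_{4\lambda}$, in this order. For a channel matrix $H\in\mathbb C^{n_r\times n_t}$ let $H_{eq}=(I_{n_t}\otimes\check H)G\in\mathbb R^{2n_rn_t\times 8\lambda}$, where $\check H$ is $H$ with every entry $z$ replaced by $\begin{pmatrix}\mathrm{Re}\,z&-\mathrm{Im}\,z\\ \mathrm{Im}\,z&\mathrm{Re}\,z\end{pmatrix}$, and the columns of $G$ are the weight matrices of $X$, vectorized by stacking their columns and replacing each entry by its real and imaginary parts. Let $R=R(H)\in\mathbb R^{8\lambda\times 8\lambda}$ be the upper triangular factor of the QR decomposition of $H_{eq}$ obtained by Gram--Schmidt orthogonalization of its columns in order, and write $R=\begin{pmatrix}R_1&E\\0&R_2\end{pmatrix}$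 with $4\lambda\times4\lambda$ blocks. Then, for every $H$ for which $R$ has full rank $8\lambda$: 1. $R_1$ and $R_2$ are upper triangular and block diagonal with $4$ blocks of size $\lambda\times\lambda$, i.e. $R$ has the zero pattern of a block orthogonal matrix with parameters $(2,4,\lambda)$; 2. the four diagonal $\lambda\times\lambda$ blocks of $R_1$ are equal; 3. there are real $\lambda\times\lambda$ matrices $E_1,E_2,E_3,E_4$ such that $$E=\begin{pmatrix}E_1&-E_2&-E_3&-E_4\\E_2&E_1&-E_4P&E_3P\\E_3&E_4P&E_1&-E_2P\\E_4&-E_3P&E_2P&E_1\end{pmatrix},$$ where $P=\varepsilon(-1)^a J$ and $J$ is the $\lambda\times\lambda$ reversal permutation matrix (ones on the antidiagonal); 4. $E^TE$ is block diagonal with $4$ blocks of size $\lambda\times\lambda$. Moreover, for (Lebesgue-)almost every $H\in\mathbb C^{n_r\times n_t}$, if $R$ has full rank then $X$ is block orthogonal with parameters $(2,4,\lambda)$: $R$ has the zero pattern of item 1, and $E$ is not the zero matrix. -/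

import Mathlib

open Matrix
open scoped Kronecker

noncomputable section

namespace STBC

/-! ### Linear space-time block codes and their `R` matrix -/

section SystemModel

variable {nr nt m n : Type*} [Fintype nr] [Fintype nt] [DecidableEq nt] {K : ℕ}

/-- The codeword `X(x₁, …, x_K) = ∑ xᵢ Aᵢ` of the linear STBC with weight matrices `A`. -/
def codeword (A : Fin K → Matrix nt nt ℂ) (x : Fin K → ℝ) : Matrix nt nt ℂ :=
  ∑ i, (x i : ℂ) • A i

/-- The real matrix obtained by replacing every entry `z` of a complex matrix by the
`2 × 2` block `[Re z, -Im z; Im z, Re z]`. -/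
def check (X : Matrix m n ℂ) : Matrix (m × Fin 2) (n × Fin 2) ℝ :=
  Matrix.of fun p q =>
    !![(X p.1 q.1).re, -(X p.1 q.1).im; (X p.1 q.1).im, (X p.1 q.1).re] p.2 q.2

/-- The columns of `X` stacked one below the other (index: column, then row), with every
complex entry replaced by its real part followed by its imaginary part. -/
def vecTilde (X : Matrix m n ℂ) : n × (m × Fin 2) → ℝ :=
  fun p => ![(X p.2.1 p.1).re, (X p.2.1 p.1).im] p.2.2

/-- The generator matrix, whose `i`-th column is the real vectorization of the `i`-th weight
matrix. -/
def generatorMatrix (A : Fin K → Matrix nt nt ℂ) : Matrix (nt × (nt × Fin 2)) (Fin K) ℝ :=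
  Matrix.of fun p i => vecTilde (A i) p

/-- The equivalent real channel matrix `H_eq = (I ⊗ Ȟ) G`. -/
def equivChannel (H : Matrix nr nt ℂ) (A : Fin K → Matrix nt nt ℂ) :
    Matrix (nt × (nr × Fin 2)) (Fin K) ℝ :=
  ((1 : Matrix nt nt ℝ) ⊗ₖ check H) * generatorMatrix A

/-- The `i`-th column `hᵢ` of the equivalent channel matrix, as a Euclidean vector. -/
def channelColumn (H : Matrix nr nt ℂ) (A : Fin K → Matrix nt nt ℂ) (i : Fin K) :
    EuclideanSpace ℝ (nt × (nr × Fin 2)) :=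
  WithLp.toLp 2 fun p => equivChannel H A p i

/-- The upper triangular factor of the QR decomposition of `H_eq` given by Gram-Schmidt
orthogonalization of the columns in their order: with `rᵢ` the orthogonalized and
`qᵢ = rᵢ / ‖rᵢ‖` the orthonormalized columns, the diagonal entries are `‖rᵢ‖` and the entries
above the diagonal are `⟨qᵢ, hⱼ⟩`. -/
def rMatrix (H : Matrix nr nt ℂ) (A : Fin K → Matrix nt nt ℂ) : Matrix (Fin K) (Fin K) ℝ :=
  Matrix.of fun i j =>
    if i < j then
      inner ℝ (InnerProductSpace.gramSchmidtNormed ℝ (channelColumn H A) i) (channelColumn H A j)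
    else if i = j then ‖InnerProductSpace.gramSchmidt ℝ (channelColumn H A) i‖
    else 0

end SystemModel

/-! ### Block orthogonality -/

/-- The zero pattern of a block orthogonal `R` matrix with parameters `(Γ, k, γ)`: `R` is an upper
triangular matrix of size `Γ k γ` cut into `Γ × Γ` blocks of size `k γ`, and each of the `Γ`
diagonal blocks is block diagonal with `k` blocks of size `γ`. -/
structure HasBlockOrthogonalPattern (Γ k γ : ℕ) {K : ℕ} (R : Matrix (Fin K) (Fin K) ℝ) :
    Prop where
  size_eq : K = Γ * (k * γ)
  upper : ∀ p q : Fin K, q < p → R p q = 0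
  blockDiag : ∀ p q : Fin K, p.val / (k * γ) = q.val / (k * γ) → p.val / γ ≠ q.val / γ →
    R p q = 0

/-- `R` is block orthogonal with parameters `(Γ, k, γ)`: it has the zero pattern, and all blocks
`B_{ij}` (`i < j`) of size `k γ` above the block diagonal are non-zero matrices. -/
structure IsBlockOrthogonal (Γ k γ : ℕ) {K : ℕ} (R : Matrix (Fin K) (Fin K) ℝ) : Prop
    extends HasBlockOrthogonalPattern Γ k γ R where
  offDiag_ne_zero : ∀ i j : ℕ, i < j → j < Γ →
    ∃ p q : Fin K, p.val / (k * γ) = i ∧ q.val / (k * γ) = j ∧ R p q ≠ 0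

/-! ### The Clifford unitary weight design for `2 ^ a` antennas -/

/-- The index set of the `2 ^ a` transmit antennas: the binary words of length `a`, which index
the rows and columns of an `a`-fold Kronecker product of `2 × 2` matrices. -/
abbrev Antenna (a : ℕ) : Type := Fin a → Fin 2

/-- The Kronecker product `B₀ ⊗ B₁ ⊗ ⋯ ⊗ B_{a-1}` of `2 × 2` matrices (leftmost factor first). -/
def kron {a : ℕ} (B : Fin a → Matrix (Fin 2) (Fin 2) ℂ) :
    Matrix (Antenna a) (Antenna a) ℂ :=
  Matrix.of fun p q => ∏ t, B t (p t) (q t)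

def sigma1 : Matrix (Fin 2) (Fin 2) ℂ := !![0, 1; -1, 0]

def sigma2 : Matrix (Fin 2) (Fin 2) ℂ := !![0, Complex.I; Complex.I, 0]

def sigma3 : Matrix (Fin 2) (Fin 2) ℂ := !![1, 0; 0, -1]

/-- `I₂^{⊗ (a-k)} ⊗ S ⊗ σ₃^{⊗ (k-1)}`, for `1 ≤ k ≤ a`. -/
def cliffordAt (a k : ℕ) (S : Matrix (Fin 2) (Fin 2) ℂ) : Matrix (Antenna a) (Antenna a) ℂ :=
  kron fun t : Fin a => if t.val + k < a then 1 else if t.val + k = a then S else sigma3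

/-- `R(γ₁) = ± j σ₃^{⊗ a}`, the sign being `ε`. -/
def gammaOne (a : ℕ) (ε : ℤˣ) : Matrix (Antenna a) (Antenna a) ℂ :=
  (((ε : ℤ) : ℂ) * Complex.I) • kron fun _ : Fin a => sigma3

/-- `R(γ_{2k})`, for `1 ≤ k ≤ a`. -/
def gammaEven (a k : ℕ) : Matrix (Antenna a) (Antenna a) ℂ := cliffordAt a k sigma1

/-- `R(γ_{2k+1})`, for `1 ≤ k ≤ a`. -/
def gammaOdd (a k : ℕ) : Matrix (Antenna a) (Antenna a) ℂ := cliffordAt a k sigma2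

/-- `αᵢ = j R(γ_{2i}) R(γ_{2i+1})`, for `1 ≤ i ≤ a - 1`. -/
def alpha (a i : ℕ) : Matrix (Antenna a) (Antenna a) ℂ :=
  Complex.I • (gammaEven a i * gammaOdd a i)

/-- The number `λ = 2 ^ (a - 1)` of weight matrices in each group. -/
abbrev groupSize (a : ℕ) : ℕ := 2 ^ (a - 1)

/-- The matrices of the first group. The zero-based index `k` stands for
`A_{k+1} = ∏ᵢ αᵢ ^ kᵢ`, where `k₁ k₂ … k_{a-1}` are the binary digits of `k`, most significant
digit first. -/
def firstGroup (a k : ℕ) : Matrix (Antenna a) (Antenna a) ℂ :=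
  (List.ofFn fun i : Fin (a - 1) => alpha a (i.val + 1) ^ (k.testBit i.rev.val).toNat).prod

/-- The leading matrices `A₁ = I`, `A_{λ+1} = R(γ₁)`, `A_{2λ+1} = R(γ_{2a+1})` and
`A_{3λ+1} = R(γ_{2a})` of the four groups. -/
def groupLeader (a : ℕ) (ε : ℤˣ) : Fin 4 → Matrix (Antenna a) (Antenna a) ℂ :=
  ![1, gammaOne a ε, gammaOdd a a, gammaEven a a]

/-- The weight matrices of the rate-1, four-group decodable CUWD: `A_{jλ+k} = A_k A_{jλ+1}`.
(`finProdFinEquiv` sends `(j, k)` to `jλ + k`, zero-based.) -/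
def cuwd (a : ℕ) (ε : ℤˣ) (l : Fin (4 * groupSize a)) : Matrix (Antenna a) (Antenna a) ℂ :=
  firstGroup a (finProdFinEquiv.symm l).2.val * groupLeader a ε (finProdFinEquiv.symm l).1

/-! ### Construction I -/

/-- The weight matrices `A₁, …, A_L, M A₁, …, M A_L`, in this order. -/
def constructionI {nt : Type*} [Fintype nt] {L : ℕ} (A : Fin L → Matrix nt nt ℂ)
    (M : Matrix nt nt ℂ) : Fin (L + L) → Matrix nt nt ℂ :=
  Fin.append A fun i => M * A i

/-- The code with these weight matrices is `X₁(s₁, …, s_L) + M X₁(s_{L+1}, …, s_{2L})`. -/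
theorem codeword_constructionI {nt : Type*} [Fintype nt] {L : ℕ}
    (A : Fin L → Matrix nt nt ℂ) (M : Matrix nt nt ℂ) (s : Fin (L + L) → ℝ) :
    codeword (constructionI A M) s =
      codeword A (fun i => s (Fin.castAdd L i)) + M * codeword A (fun i => s (Fin.natAdd L i)) := by
  simp only [codeword, constructionI, Fin.sum_univ_add, Fin.append_left, Fin.append_right,
    Finset.mul_sum, Matrix.mul_smul]

/-- The `R` matrix, over the channel `H`, of the code `X₁ + M X₁` built from the CUWD. -/
def rConstructionI (a : ℕ) (ε : ℤˣ) (M : Matrix (Antenna a) (Antenna a) ℂ) {nr : ℕ}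
    (H : Matrix (Fin nr) (Antenna a) ℂ) :
    Matrix (Fin (4 * groupSize a + 4 * groupSize a)) (Fin (4 * groupSize a + 4 * groupSize a)) ℝ :=
  rMatrix H (constructionI (cuwd a ε) M)

section Blocks

variable {L : ℕ}

/-- The upper left block `R₁` of `R = [R₁, E; 0, R₂]`. -/
def blockR1 (R : Matrix (Fin (L + L)) (Fin (L + L)) ℝ) : Matrix (Fin L) (Fin L) ℝ :=
  R.submatrix (Fin.castAdd L) (Fin.castAdd L)

/-- The upper right block `E` of `R = [R₁, E; 0, R₂]`. -/
def blockE (R : Matrix (Fin (L + L)) (Fin (L + L)) ℝ) : Matrix (Fin L) (Fin L) ℝ :=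
  R.submatrix (Fin.castAdd L) (Fin.natAdd L)

/-- A matrix of size `k γ` cut into `k × k` blocks of size `γ`; entry `(i, j)` is the block. -/
def blocks {k γ : ℕ} (N : Matrix (Fin (k * γ)) (Fin (k * γ)) ℝ) :
    Matrix (Fin k) (Fin k) (Matrix (Fin γ) (Fin γ) ℝ) :=
  Matrix.of fun i j => N.submatrix (fun u => finProdFinEquiv (i, u)) fun u => finProdFinEquiv (j, u)

/-- The reversal permutation matrix (ones on the antidiagonal). -/
def reversal (γ : ℕ) : Matrix (Fin γ) (Fin γ) ℝ :=
  Matrix.of fun i j => if j = i.rev then 1 else 0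

end Blocks

end STBC

end

/-!
Right multiplication by a complex matrix `B` acts on the vectorized channel matrices, a real
Euclidean space, as an operator `ρ(B)` with adjoint `ρ(Bᴴ)`. With `x = vec H` and `y = vec (H M)`,
the columns of the equivalent channel are `ρ(A_i) x` followed by `ρ(A_i) y`: two orbits under the
weight matrices. Everything follows from the algebra of the `A_i`. Write `A_{lλ+k} = D_k L_l`.

* The `D_k` are commuting Hermitian diagonal sign matrices with `D_k D_k' = D_{k xor k'}`
  (zero-based indices); in particular multiplication by the last one reverses the order of the
  group (`firstGroup_last_mul`). They commute with the leaders `L_l`.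
* The leaders `L₁, L₂, L₃` are anti-Hermitian, anticommute and square to `-1`, and multiply like
  the quaternion units up to `Z = ε (-1)^a A_λ` (`groupLeader_mul`).

So `A_i A_jᴴ` is skew-Hermitian for `i`, `j` in different groups, which makes the groups of any
orbit orthogonal, and each group is the isometric image of the first under its leader. Gram-Schmidt
vectors being characterized by orthogonality and triangularity, the orthogonalization of an orbit is
that of its first group carried over by the leaders (`gramSchmidt_orbit`); this gives the shape of
`R₁`. The real span of the `A_i` is an algebra closed under adjoints (`cuwd_mul`,
`cuwd_conjTranspose`), so the orthogonal projection onto the span of the first orbit commutes with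
all `ρ(A_i)`. Hence `R₂` is the factor of the orbit of the residual of `y`, and `EᵀE` is the Gram
matrix of the orbit of the projection of `y` (`crossMatrix_transpose_mul_self`). The block `(l, m)`
of `E` depends only on `L_m L_lᴴ`, and the quaternion relations give the pattern of `E`
(`blocks_crossMatrix`).

For the generic statement, `E ≠ 0` as soon as one of the quadratic forms `⟨vec H, vec (H M A_j)⟩` is
nonzero at `H`. A nonzero quadratic form vanishes only on a null set. If all of them vanish
identically, all `M A_j` are skew-Hermitian, so `M` anticommutes with the leaders but commutes with
their product, which forces `H M = 0`; then half of the columns vanish and `R` does not have full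
rank.
-/

namespace STBC

/-! ### Kronecker products of `2 × 2` matrices and the group leaders -/

theorem kron_mul {a : ℕ} (B C : Fin a → Matrix (Fin 2) (Fin 2) ℂ) :
    kron B * kron C = kron fun t => B t * C t := by
  ext p q
  simp only [kron, mul_apply, of_apply, Finset.prod_univ_sum, Fintype.piFinset_univ,
    Finset.prod_mul_distrib]

theorem kron_conjTranspose {a : ℕ} (B : Fin a → Matrix (Fin 2) (Fin 2) ℂ) :
    (kron B)ᴴ = kron fun t => (B t)ᴴ := by
  ext p q
  simp only [kron, conjTranspose_apply, of_apply, star_prod]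

theorem kron_diagonal {a : ℕ} (d : Fin a → Fin 2 → ℂ) :
    kron (fun t => diagonal (d t)) = diagonal fun p => ∏ t, d t (p t) := by
  ext p q
  simp only [kron, of_apply]
  rcases eq_or_ne p q with rfl | h
  · simp
  · obtain ⟨t, ht⟩ := Function.ne_iff.mp h
    rw [diagonal_apply_ne _ h]
    exact Finset.prod_eq_zero (Finset.mem_univ t) (diagonal_apply_ne _ ht)

/-- The Kronecker product `S ⊗ T ⊗ ⋯ ⊗ T` with `n` factors `T`. -/
noncomputable def leadKron (n : ℕ) (S T : Matrix (Fin 2) (Fin 2) ℂ) :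
    Matrix (Antenna (n + 1)) (Antenna (n + 1)) ℂ :=
  kron fun t => if t = 0 then S else T

theorem leadKron_apply {n : ℕ} (S T : Matrix (Fin 2) (Fin 2) ℂ) (p q : Antenna (n + 1)) :
    leadKron n S T p q = S (p 0) (q 0) * ∏ t : Fin n, T (p t.succ) (q t.succ) := by
  simp [leadKron, kron, Fin.prod_univ_succ, Fin.succ_ne_zero]

theorem leadKron_mul {n : ℕ} (S T S' T' : Matrix (Fin 2) (Fin 2) ℂ) :
    leadKron n S T * leadKron n S' T' = leadKron n (S * S') (T * T') := by
  rw [leadKron, leadKron, kron_mul, leadKron]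
  congr 1
  ext1 t
  split_ifs <;> rfl

theorem leadKron_conjTranspose {n : ℕ} (S T : Matrix (Fin 2) (Fin 2) ℂ) :
    (leadKron n S T)ᴴ = leadKron n Sᴴ Tᴴ := by
  rw [leadKron, kron_conjTranspose, leadKron]
  congr 1
  ext1 t
  split_ifs <;> rfl

theorem leadKron_smul {n : ℕ} (c : ℂ) (S T : Matrix (Fin 2) (Fin 2) ℂ) :
    leadKron n (c • S) T = c • leadKron n S T := by
  ext p q
  simp only [leadKron_apply, Matrix.smul_apply, smul_eq_mul, mul_assoc]

theorem leadKron_neg {n : ℕ} (S T : Matrix (Fin 2) (Fin 2) ℂ) :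
    leadKron n (-S) T = -leadKron n S T := by
  simpa using leadKron_smul (-1) S T

theorem leadKron_one {n : ℕ} : leadKron n 1 1 = 1 := by
  have h := kron_diagonal (a := n + 1) fun _ _ => 1
  simpa [leadKron] using h

theorem sigma3_eq_diagonal : sigma3 = diagonal ![1, -1] := by
  ext i j
  fin_cases i <;> fin_cases j <;> simp [sigma3]

theorem sigma3_mul_self : sigma3 * sigma3 = 1 := by
  ext i j
  fin_cases i <;> fin_cases j <;> simp [sigma3]

theorem sigma3_conjTranspose : sigma3ᴴ = sigma3 := by
  ext i j
  fin_cases i <;> fin_cases j <;> simp [sigma3]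

theorem sigma1_mul_sigma2 : sigma1 * sigma2 = Complex.I • sigma3 := by
  ext i j
  fin_cases i <;> fin_cases j <;> simp [sigma1, sigma2, sigma3]

/-- The leading `2 × 2` factors of the four group leaders, scaled so that every other Kronecker
factor is `1` (for the first leader) or `σ₃` (for the other three). -/
noncomputable def leadFactor (ε : ℤˣ) : Fin 4 → Matrix (Fin 2) (Fin 2) ℂ :=
  ![1, (((ε : ℤ) : ℂ) * Complex.I) • sigma3, sigma2, sigma1]

theorem groupLeader_eq_leadKron {n : ℕ} (ε : ℤˣ) (l : Fin 4) :
    groupLeader (n + 1) ε l = leadKron n (leadFactor ε l) (if l = 0 then 1 else sigma3) := by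
  have h : ∀ S, cliffordAt (n + 1) (n + 1) S = leadKron n S sigma3 := by
    intro S
    rw [cliffordAt, leadKron]
    congr 1
    ext1 t
    rw [if_neg (by omega)]
    refine if_congr ?_ rfl rfl
    rw [Fin.ext_iff, Fin.val_zero]
    omega
  fin_cases l
  · exact leadKron_one.symm
  · change gammaOne _ _ = leadKron n ((((ε : ℤ) : ℂ) * Complex.I) • sigma3) sigma3
    rw [gammaOne, leadKron_smul, leadKron]
    simp only [ite_self]
  · exact h _
  · exact h _

/-! ### The first group as diagonal sign matrices -/

/-- The value at the antenna `p` of the diagonal matrix `A_{k+1}`: the `i`-th binary digit of `k`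
contributes a factor `-σ₃` in the tensor position `i + 1`. -/
noncomputable def walsh (n k : ℕ) (p : Antenna (n + 1)) : ℂ :=
  ∏ i : Fin n, if k.testBit i then -(![1, -1] (p i.succ)) else 1

theorem alpha_eq_diagonal {n : ℕ} (i : Fin n) :
    alpha (n + 1) (i.val + 1) = diagonal fun p => -(![1, -1] (p i.rev.succ)) := by
  have h : (fun t : Fin (n + 1) =>
      (if t.val + (i.val + 1) < n + 1 then 1 else if t.val + (i.val + 1) = n + 1 then sigma1
        else sigma3) *
      (if t.val + (i.val + 1) < n + 1 then 1 else if t.val + (i.val + 1) = n + 1 then sigma2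
        else sigma3)) =
      fun t => diagonal (if t = i.rev.succ then Complex.I • ![1, -1] else 1) := by
    ext1 t
    have ht : t = i.rev.succ ↔ t.val + (i.val + 1) = n + 1 := by
      have := i.isLt
      rw [Fin.ext_iff, Fin.val_succ, Fin.val_rev]
      omega
    by_cases h1 : t = i.rev.succ
    · have h2 := ht.mp h1
      rw [if_neg (by omega), if_pos h2, if_neg (by omega), if_pos h2, if_pos h1,
        sigma1_mul_sigma2, sigma3_eq_diagonal, diagonal_smul]
    · have h2 := mt ht.mpr h1
      rw [if_neg h2, if_neg h2, if_neg h1]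
      split_ifs
      · rw [mul_one]; exact diagonal_one.symm
      · rw [sigma3_mul_self]; exact diagonal_one.symm
  rw [alpha, gammaEven, gammaOdd, cliffordAt, cliffordAt, kron_mul, h, kron_diagonal,
    ← diagonal_smul]
  congr 1
  ext1 p
  rw [Pi.smul_apply, Finset.prod_eq_single i.rev.succ]
  · simp [← mul_assoc]
  · intro t _ ht
    simp [ht]
  · simp

theorem firstGroup_eq_diagonal (n k : ℕ) : firstGroup (n + 1) k = diagonal (walsh n k) := by
  have h : (fun i : Fin n => alpha (n + 1) (i.val + 1) ^ (k.testBit i.rev.val).toNat) =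
      fun i => diagonalRingHom _ ℂ fun p =>
        if k.testBit i.rev.val then -(![1, -1] (p i.rev.succ)) else 1 := by
    ext1 i
    rw [alpha_eq_diagonal]
    cases k.testBit i.rev.val
    · simp
    · simp
  have h' : firstGroup (n + 1) k =
      (List.ofFn fun i : Fin n => alpha (n + 1) (i.val + 1) ^ (k.testBit i.rev.val).toNat).prod :=
    rfl
  rw [h', h]
  change (List.ofFn (diagonalRingHom _ ℂ ∘ _)).prod = _
  rw [← List.map_ofFn, ← map_list_prod, List.prod_ofFn, diagonalRingHom_apply]
  congr 1
  ext1 p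
  rw [Finset.prod_apply, walsh]
  exact Fintype.prod_equiv Fin.revPerm _ _ fun i => rfl

theorem sigma3_diag_eq_or {n : ℕ} (p : Antenna (n + 1)) (i : Fin n) :
    (![1, -1] (p i.succ) : ℂ) = 1 ∨ (![1, -1] (p i.succ) : ℂ) = -1 := by
  generalize p i.succ = j
  fin_cases j <;> simp

theorem walsh_mul (n k k' : ℕ) (p : Antenna (n + 1)) :
    walsh n k p * walsh n k' p = walsh n (k ^^^ k') p := by
  rw [walsh, walsh, walsh, ← Finset.prod_mul_distrib]
  refine Finset.prod_congr rfl fun i _ => ?_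
  rw [Nat.testBit_xor]
  rcases sigma3_diag_eq_or p i with h | h <;> rw [h] <;> cases k.testBit i <;> cases k'.testBit i <;> simp

theorem star_walsh (n k : ℕ) (p : Antenna (n + 1)) : star (walsh n k p) = walsh n k p := by
  rw [walsh, star_prod]
  refine Finset.prod_congr rfl fun i _ => ?_
  rcases sigma3_diag_eq_or p i with h | h <;> rw [h] <;> cases k.testBit i <;> simp

theorem firstGroup_mul (n k k' : ℕ) :
    firstGroup (n + 1) k * firstGroup (n + 1) k' = firstGroup (n + 1) (k ^^^ k') := by
  simp only [firstGroup_eq_diagonal, diagonal_mul_diagonal, walsh_mul]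

theorem firstGroup_zero (n : ℕ) : firstGroup (n + 1) 0 = 1 := by
  rw [firstGroup_eq_diagonal, ← diagonal_one]
  congr 1
  ext1 p
  simp [walsh]

theorem firstGroup_conjTranspose (n k : ℕ) :
    (firstGroup (n + 1) k)ᴴ = firstGroup (n + 1) k := by
  rw [firstGroup_eq_diagonal, diagonal_conjTranspose]
  congr 1
  ext1 p
  exact star_walsh n k p

theorem firstGroup_comm (n k k' : ℕ) :
    Commute (firstGroup (n + 1) k) (firstGroup (n + 1) k') := by
  rw [Commute, SemiconjBy, firstGroup_mul, firstGroup_mul, Nat.xor_comm]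

theorem firstGroup_mul_self (n k : ℕ) : firstGroup (n + 1) k * firstGroup (n + 1) k = 1 := by
  rw [firstGroup_mul, Nat.xor_self, firstGroup_zero]

/-- The leading tensor position is free of `σ₃` in every matrix of the first group. -/
theorem firstGroup_commute_leadKron (n k : ℕ) (S : Matrix (Fin 2) (Fin 2) ℂ) (d : Fin 2 → ℂ) :
    Commute (firstGroup (n + 1) k) (leadKron n S (diagonal d)) := by
  ext p q
  rw [firstGroup_eq_diagonal, diagonal_mul, mul_diagonal, mul_comm]
  by_cases h : ∀ t : Fin n, p t.succ = q t.succ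
  · congr 1
    simp only [walsh, h]
  · obtain ⟨t, ht⟩ := not_forall.mp h
    have h0 : leadKron n S (diagonal d) p q = 0 := by
      rw [leadKron_apply]
      exact mul_eq_zero_of_right _
        (Finset.prod_eq_zero (Finset.mem_univ t) (diagonal_apply_ne _ ht))
    rw [h0, zero_mul, zero_mul]

theorem firstGroup_commute_groupLeader (n k : ℕ) (ε : ℤˣ) (l : Fin 4) :
    Commute (firstGroup (n + 1) k) (groupLeader (n + 1) ε l) := by
  rw [groupLeader_eq_leadKron]
  split_ifs
  · rw [← diagonal_one]; exact firstGroup_commute_leadKron ..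
  · rw [sigma3_eq_diagonal]; exact firstGroup_commute_leadKron ..

theorem firstGroup_last (n : ℕ) :
    firstGroup (n + 1) (2 ^ n - 1) = (-1 : ℂ) ^ n • leadKron n 1 sigma3 := by
  have h : leadKron n 1 sigma3 =
      diagonal fun p : Antenna (n + 1) => ∏ i : Fin n, ![1, -1] (p i.succ) := by
    rw [leadKron, sigma3_eq_diagonal, ← diagonal_one]
    have := kron_diagonal (a := n + 1) fun t => if t = 0 then 1 else ![1, -1]
    simp only [Fin.prod_univ_succ, if_true, Fin.succ_ne_zero, if_false, Pi.one_apply,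
      one_mul] at this
    rw [← this]
    congr 1
    ext1 t
    split_ifs <;> rfl
  rw [h, firstGroup_eq_diagonal, ← diagonal_smul]
  congr 1
  ext1 p
  simp [walsh, Nat.testBit_two_pow_sub_one, Finset.prod_neg]

/-- Multiplication by the last matrix of the first group flips every binary digit of the index. -/
theorem firstGroup_last_mul {n : ℕ} (k : Fin (2 ^ n)) :
    firstGroup (n + 1) k * firstGroup (n + 1) (2 ^ n - 1) = firstGroup (n + 1) k.rev := by
  simp only [firstGroup_eq_diagonal, diagonal_mul_diagonal, walsh_mul]
  congr 1
  ext1 p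
  refine Finset.prod_congr rfl fun i _ => ?_
  rw [Fin.val_rev, Nat.testBit_two_pow_sub_succ k.isLt, Nat.testBit_xor,
    Nat.testBit_two_pow_sub_one]
  simp

/-! ### Quaternion relations of the leaders -/

theorem firstGroup_last_smul (n : ℕ) (ε : ℤˣ) :
    (((ε : ℤ) : ℂ) * (-1) ^ (n + 1)) • firstGroup (n + 1) (2 ^ n - 1) =
      leadKron n (-((ε : ℤ) : ℂ) • 1) sigma3 := by
  rw [firstGroup_last, leadKron_smul, smul_smul, pow_succ, mul_assoc, mul_neg, mul_one, neg_mul,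
    ← mul_pow]
  simp

theorem groupLeader_zero (n : ℕ) (ε : ℤˣ) : groupLeader n ε 0 = 1 := rfl

theorem groupLeader_conjTranspose (n : ℕ) (ε : ℤˣ) (l : Fin 4) (hl : l ≠ 0) :
    (groupLeader (n + 1) ε l)ᴴ = -groupLeader (n + 1) ε l := by
  have h : (leadFactor ε l)ᴴ = -leadFactor ε l := by
    fin_cases l
    · exact absurd rfl hl
    all_goals
      ext i j
      fin_cases i <;> fin_cases j <;> simp [leadFactor, sigma1, sigma2, sigma3]
  rw [groupLeader_eq_leadKron, leadKron_conjTranspose, if_neg hl, sigma3_conjTranspose, h,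
    leadKron_neg]

theorem groupLeader_mul_self (n : ℕ) (ε : ℤˣ) (l : Fin 4) (hl : l ≠ 0) :
    groupLeader (n + 1) ε l * groupLeader (n + 1) ε l = -1 := by
  have h : leadFactor ε l * leadFactor ε l = -1 := by
    fin_cases l
    · exact absurd rfl hl
    all_goals
      ext i j
      rcases Int.units_eq_one_or ε with rfl | rfl <;>
      fin_cases i <;> fin_cases j <;> simp [leadFactor, sigma1, sigma2, sigma3]
  rw [groupLeader_eq_leadKron, leadKron_mul, if_neg hl, sigma3_mul_self, h, leadKron_neg,
    leadKron_one]

/-- Up to the Hermitian unitary `ε (-1)^a A_λ`, the three leaders multiply like the imaginary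
quaternion units. -/
theorem groupLeader_mul (n : ℕ) (ε : ℤˣ) (l m r : Fin 4)
    (h : (l, m, r) ∈ ({(1, 2, 3), (2, 3, 1), (3, 1, 2)} : Finset (Fin 4 × Fin 4 × Fin 4))) :
    groupLeader (n + 1) ε l * groupLeader (n + 1) ε m =
      ((((ε : ℤ) : ℂ) * (-1) ^ (n + 1)) • firstGroup (n + 1) (2 ^ n - 1)) *
        groupLeader (n + 1) ε r := by
  have h' : leadFactor ε l * leadFactor ε m = (-((ε : ℤ) : ℂ) • 1) * leadFactor ε r := by
    simp only [Finset.mem_insert, Finset.mem_singleton, Prod.mk.injEq] at h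
    rcases Int.units_eq_one_or ε with rfl | rfl <;>
    rcases h with ⟨rfl, rfl, rfl⟩ | ⟨rfl, rfl, rfl⟩ | ⟨rfl, rfl, rfl⟩ <;>
    ext i j <;>
    fin_cases i <;> fin_cases j <;> simp [leadFactor, sigma1, sigma2, sigma3]
  have hl : l ≠ 0 ∧ m ≠ 0 ∧ r ≠ 0 := by
    simp only [Finset.mem_insert, Finset.mem_singleton, Prod.mk.injEq] at h
    rcases h with ⟨rfl, rfl, rfl⟩ | ⟨rfl, rfl, rfl⟩ | ⟨rfl, rfl, rfl⟩ <;> decide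
  rw [firstGroup_last_smul]
  simp only [groupLeader_eq_leadKron, if_neg hl.1, if_neg hl.2.1, if_neg hl.2.2, leadKron_mul, h',
    sigma3_mul_self]

theorem groupLeader_anticomm (n : ℕ) (ε : ℤˣ) (l m : Fin 4) (hl : l ≠ 0) (hm : m ≠ 0)
    (hlm : l ≠ m) :
    groupLeader (n + 1) ε m * groupLeader (n + 1) ε l =
      -(groupLeader (n + 1) ε l * groupLeader (n + 1) ε m) := by
  have h : leadFactor ε m * leadFactor ε l = -(leadFactor ε l * leadFactor ε m) := by
    fin_cases l <;> fin_cases m <;>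
    first
    | exact absurd rfl hl
    | exact absurd rfl hm
    | exact absurd rfl hlm
    | ext i j
      fin_cases i <;> fin_cases j <;> simp [leadFactor, sigma1, sigma2, sigma3, mul_comm]
  simp only [groupLeader_eq_leadKron, leadKron_mul, if_neg hl, if_neg hm, h, leadKron_neg]

/-! ### Gram-Schmidt orthogonalization -/

section GramSchmidt

open InnerProductSpace

variable {E ι : Type*} [NormedAddCommGroup E] [InnerProductSpace ℝ E]

theorem inner_eq_zero_of_mem_span {s : Set E} {x y : E} (hx : x ∈ Submodule.span ℝ s)
    (h : ∀ z ∈ s, inner ℝ z y = 0) : inner ℝ x y = 0 := by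
  induction hx using Submodule.span_induction with
  | mem z hz => exact h z hz
  | zero => exact inner_zero_left _
  | add u v _ _ hu hv => rw [inner_add_left, hu, hv, add_zero]
  | smul c u _ hu => rw [real_inner_smul_left, hu, mul_zero]

section

variable [LinearOrder ι] [LocallyFiniteOrderBot ι] [WellFoundedLT ι]

theorem gramSchmidtNormed_eq_smul (f : ι → E) (n : ι) :
    gramSchmidtNormed ℝ f n = ‖gramSchmidt ℝ f n‖⁻¹ • gramSchmidt ℝ f n := by
  simp [gramSchmidtNormed]

theorem sub_gramSchmidt_mem_span (f : ι → E) (n : ι) :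
    f n - gramSchmidt ℝ f n ∈ Submodule.span ℝ (f '' Set.Iio n) := by
  rw [gramSchmidt_def, sub_sub_cancel, ← span_gramSchmidt_Iio ℝ f n]
  refine Submodule.sum_mem _ fun i hi => ?_
  have h := (ℝ ∙ gramSchmidt ℝ f i).starProjection_apply_mem (f n)
  refine Submodule.span_mono ?_ h
  rintro _ rfl
  exact ⟨i, Finset.mem_Iio.mp hi, rfl⟩

theorem inner_gramSchmidt_of_lt (f : ι → E) {i n : ι} (hi : i < n) :
    inner ℝ (f i) (gramSchmidt ℝ f n) = 0 := by
  rw [real_inner_comm]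
  exact gramSchmidt_inv_triangular ℝ f hi

theorem gramSchmidt_mem_span_range (f : ι → E) (n : ι) :
    gramSchmidt ℝ f n ∈ Submodule.span ℝ (Set.range f) :=
  Submodule.span_mono (Set.image_subset_range _ _) (gramSchmidt_mem_span ℝ f le_rfl)

theorem gramSchmidtNormed_mem_span_range (f : ι → E) (n : ι) :
    gramSchmidtNormed ℝ f n ∈ Submodule.span ℝ (Set.range f) := by
  rw [gramSchmidtNormed_eq_smul]
  exact Submodule.smul_mem _ _ (gramSchmidt_mem_span_range f n)

/-- The orthogonalized vector is the only one that differs from `f n` by a combination of the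
earlier vectors and is orthogonal to these. -/
theorem gramSchmidt_eq_of_sub_mem_span {f : ι → E} {n : ι} {v : E}
    (hv : f n - v ∈ Submodule.span ℝ (f '' Set.Iio n)) (h : ∀ i < n, inner ℝ (f i) v = 0) :
    gramSchmidt ℝ f n = v := by
  have hmem : gramSchmidt ℝ f n - v ∈ Submodule.span ℝ (f '' Set.Iio n) := by
    have := Submodule.sub_mem _ hv (sub_gramSchmidt_mem_span f n)
    rwa [sub_sub_sub_cancel_left] at this
  refine sub_eq_zero.mp (inner_self_eq_zero (𝕜 := ℝ) |>.mp ?_)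
  refine inner_eq_zero_of_mem_span hmem ?_
  rintro _ ⟨i, hi, rfl⟩
  rw [inner_sub_right, inner_gramSchmidt_of_lt f hi, h i hi, sub_zero]

/-- Parseval's identity for the normalized Gram-Schmidt vectors, of which some may vanish. -/
theorem sum_inner_gramSchmidtNormed [Fintype ι] (f : ι → E) {x : E}
    (hx : x ∈ Submodule.span ℝ (Set.range f)) (y : E) :
    ∑ p, inner ℝ (gramSchmidtNormed ℝ f p) x * inner ℝ (gramSchmidtNormed ℝ f p) y =
      inner ℝ x y := by
  rw [← span_gramSchmidt ℝ f, ← span_gramSchmidtNormed_range] at hx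
  induction hx using Submodule.span_induction with
  | mem z hz =>
    obtain ⟨r, rfl⟩ := hz
    have horth : ∀ p, p ≠ r →
        inner ℝ (gramSchmidtNormed ℝ f p) (gramSchmidtNormed ℝ f r) = 0 := by
      intro p hp
      rw [gramSchmidtNormed_eq_smul, gramSchmidtNormed_eq_smul, real_inner_smul_left,
        real_inner_smul_right, gramSchmidt_orthogonal ℝ f hp, mul_zero, mul_zero]
    rw [Finset.sum_eq_single r (fun p _ hp => by rw [horth p hp, zero_mul]) (by simp)]
    by_cases h0 : gramSchmidtNormed ℝ f r = 0
    · simp [h0]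
    · rw [real_inner_self_eq_norm_sq, gramSchmidtNormed_unit_length' h0]
      simp
  | zero => simp
  | add u v _ _ hu hv =>
    simp only [inner_add_right, inner_add_left, add_mul, Finset.sum_add_distrib, hu, hv]
  | smul c u _ hu =>
    simp only [real_inner_smul_right, real_inner_smul_left, mul_assoc, ← Finset.mul_sum, hu]

/-- The upper triangular factor of the QR decomposition by Gram-Schmidt orthogonalization of a
family of vectors. -/
noncomputable def qrFactor (f : ι → E) : Matrix ι ι ℝ :=
  Matrix.of fun i j =>
    if i < j then inner ℝ (gramSchmidtNormed ℝ f i) (f j)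
    else if i = j then ‖gramSchmidt ℝ f i‖
    else 0

end

variable {m n : ℕ}

theorem gramSchmidt_castAdd (f : Fin (m + n) → E) (i : Fin m) :
    gramSchmidt ℝ f (Fin.castAdd n i) = gramSchmidt ℝ (fun i => f (Fin.castAdd n i)) i := by
  have hlt : ∀ {j : Fin m}, Fin.castAdd n j < Fin.castAdd n i ↔ j < i := Iff.rfl
  refine gramSchmidt_eq_of_sub_mem_span ?_ fun j hj => ?_
  · refine Submodule.span_mono ?_ (sub_gramSchmidt_mem_span (fun i => f (Fin.castAdd n i)) i)
    rintro _ ⟨j, hj, rfl⟩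
    exact ⟨_, hlt.mpr hj, rfl⟩
  · induction j using Fin.addCases with
    | left j => exact inner_gramSchmidt_of_lt (fun i => f (Fin.castAdd n i)) (hlt.mp hj)
    | right j =>
      have := i.isLt
      simp only [Fin.lt_def, Fin.val_natAdd, Fin.val_castAdd] at hj
      omega

/-- Orthogonalization of the later vectors against the earlier ones may be performed first. -/
theorem gramSchmidt_natAdd (f : Fin (m + n) → E) (g : Fin n → E)
    (hg : ∀ j, f (Fin.natAdd m j) - g j ∈
      Submodule.span ℝ (Set.range fun i => f (Fin.castAdd n i)))
    (horth : ∀ i j, inner ℝ (f (Fin.castAdd n i)) (g j) = 0) (j : Fin n) :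
    gramSchmidt ℝ f (Fin.natAdd m j) = gramSchmidt ℝ g j := by
  have hspan : Submodule.span ℝ (Set.range fun i => f (Fin.castAdd n i)) ≤
      Submodule.span ℝ (f '' Set.Iio (Fin.natAdd m j)) := by
    refine Submodule.span_mono ?_
    rintro _ ⟨i, rfl⟩
    refine ⟨_, ?_, rfl⟩
    have := i.isLt
    simp only [Set.mem_Iio, Fin.lt_def, Fin.val_natAdd, Fin.val_castAdd]
    omega
  have hlt : ∀ {i : Fin n}, Fin.natAdd m i < Fin.natAdd m j ↔ i < j := by
    intro i
    simp
  have hzero : ∀ x ∈ Submodule.span ℝ (Set.range fun i => f (Fin.castAdd n i)),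
      inner ℝ x (gramSchmidt ℝ g j) = 0 := by
    intro x hx
    rw [real_inner_comm]
    refine inner_eq_zero_of_mem_span (gramSchmidt_mem_span_range g j) ?_
    rintro _ ⟨i, rfl⟩
    rw [real_inner_comm]
    refine inner_eq_zero_of_mem_span hx ?_
    rintro _ ⟨k, rfl⟩
    exact horth k i
  refine gramSchmidt_eq_of_sub_mem_span ?_ fun i hi => ?_
  · rw [← sub_add_sub_cancel _ (g j)]
    refine Submodule.add_mem _ (hspan (hg j)) ?_
    refine Submodule.span_le.mpr ?_ (sub_gramSchmidt_mem_span g j)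
    rintro _ ⟨i, hi, rfl⟩
    have h1 : f (Fin.natAdd m i) ∈ Submodule.span ℝ (f '' Set.Iio (Fin.natAdd m j)) :=
      Submodule.subset_span ⟨_, hlt.mpr hi, rfl⟩
    simpa using Submodule.sub_mem _ h1 (hspan (hg i))
  · induction i using Fin.addCases with
    | left i => exact hzero _ (Submodule.subset_span ⟨i, rfl⟩)
    | right i =>
      rw [← sub_add_cancel (f (Fin.natAdd m i)) (g i), inner_add_left, hzero _ (hg i),
        inner_gramSchmidt_of_lt g (hlt.mp hi), add_zero]

theorem qrFactor_castAdd_castAdd (f : Fin (m + n) → E) (i j : Fin m) :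
    qrFactor f (Fin.castAdd n i) (Fin.castAdd n j) =
      qrFactor (fun i => f (Fin.castAdd n i)) i j := by
  have h : Fin.castAdd n i < Fin.castAdd n j ↔ i < j := Iff.rfl
  simp [qrFactor, gramSchmidtNormed_eq_smul, gramSchmidt_castAdd, h]

theorem qrFactor_castAdd_natAdd (f : Fin (m + n) → E) (i : Fin m) (j : Fin n) :
    qrFactor f (Fin.castAdd n i) (Fin.natAdd m j) =
      inner ℝ (gramSchmidtNormed ℝ (fun i => f (Fin.castAdd n i)) i) (f (Fin.natAdd m j)) := by
  have h : Fin.castAdd n i < Fin.natAdd m j := by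
    have := i.isLt
    simp only [Fin.lt_def, Fin.val_natAdd, Fin.val_castAdd]
    omega
  simp [qrFactor, h, gramSchmidtNormed_eq_smul, gramSchmidt_castAdd]

theorem qrFactor_natAdd_natAdd (f : Fin (m + n) → E) (g : Fin n → E)
    (hg : ∀ j, f (Fin.natAdd m j) - g j ∈
      Submodule.span ℝ (Set.range fun i => f (Fin.castAdd n i)))
    (horth : ∀ i j, inner ℝ (f (Fin.castAdd n i)) (g j) = 0) (i j : Fin n) :
    qrFactor f (Fin.natAdd m i) (Fin.natAdd m j) = qrFactor g i j := by
  have h : inner ℝ (gramSchmidt ℝ g i) (f (Fin.natAdd m j)) =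
      inner ℝ (gramSchmidt ℝ g i) (g j) := by
    rw [← sub_eq_zero, ← inner_sub_right]
    refine inner_eq_zero_of_mem_span (gramSchmidt_mem_span_range g i) ?_
    rintro _ ⟨k, rfl⟩
    rw [real_inner_comm]
    refine inner_eq_zero_of_mem_span (hg j) ?_
    rintro _ ⟨r, rfl⟩
    exact horth r k
  simp [qrFactor, gramSchmidtNormed_eq_smul, gramSchmidt_natAdd f g hg horth,
    real_inner_smul_left, h]

end GramSchmidt

/-! ### Right multiplication as an operator on vectorized matrices -/

section RightMultiplication

variable {nr nt : Type*} [Fintype nt]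

/-- Complex matrices as a real Euclidean space: the real vectorization of all entries. -/
noncomputable def vecEquiv (nr nt : Type*) :
    Matrix nr nt ℂ ≃ₗ[ℝ] EuclideanSpace ℝ (nt × (nr × Fin 2)) where
  toFun X := WithLp.toLp 2 (vecTilde X)
  invFun v := Matrix.of fun i j => ⟨v (j, (i, 0)), v (j, (i, 1))⟩
  map_add' X Y := by
    ext ⟨j, i, b⟩
    fin_cases b <;> simp [vecTilde]
  map_smul' c X := by
    ext ⟨j, i, b⟩
    fin_cases b <;> simp [vecTilde]
  left_inv X := by
    ext i j
    simp [vecTilde]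
  right_inv v := by
    ext ⟨j, i, b⟩
    fin_cases b <;> simp [vecTilde]

theorem inner_vecEquiv [Fintype nr] (X Y : Matrix nr nt ℂ) :
    inner ℝ (vecEquiv nr nt X) (vecEquiv nr nt Y) = (Xᴴ * Y).trace.re := by
  simp [vecEquiv, vecTilde, PiLp.inner_apply, Fintype.sum_prod_type, trace, mul_apply,
    Fin.sum_univ_two]
  refine Finset.sum_congr rfl fun j _ => Finset.sum_congr rfl fun i _ => ?_
  ring

theorem channelColumn_eq_vecEquiv [DecidableEq nt] {K : ℕ} (H : Matrix nr nt ℂ)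
    (A : Fin K → Matrix nt nt ℂ) (i : Fin K) :
    channelColumn H A i = vecEquiv nr nt (H * A i) := by
  ext ⟨j, r, b⟩
  fin_cases b <;>
  simp [channelColumn, equivChannel, vecEquiv, vecTilde, generatorMatrix, mul_apply,
    Fintype.sum_prod_type, Fin.sum_univ_two, one_apply, check, sub_eq_add_neg,
    Finset.sum_ite_irrel, Finset.sum_ite_eq, add_comm]

/-- Right multiplication of `nr × nt` matrices by `B`, as an operator on their real
vectorizations. -/
noncomputable def rightMul (nr : Type*) (B : Matrix nt nt ℂ) :
    EuclideanSpace ℝ (nt × (nr × Fin 2)) →ₗ[ℝ] EuclideanSpace ℝ (nt × (nr × Fin 2)) where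
  toFun v := vecEquiv nr nt ((vecEquiv nr nt).symm v * B)
  map_add' u v := by rw [map_add, Matrix.add_mul, map_add]
  map_smul' c v := by rw [map_smul, Matrix.smul_mul, map_smul, RingHom.id_apply]

theorem rightMul_vecEquiv (X : Matrix nr nt ℂ) (B : Matrix nt nt ℂ) :
    rightMul nr B (vecEquiv nr nt X) = vecEquiv nr nt (X * B) := by
  simp [rightMul]

theorem rightMul_rightMul (B C : Matrix nt nt ℂ) (x : EuclideanSpace ℝ (nt × (nr × Fin 2))) :
    rightMul nr C (rightMul nr B x) = rightMul nr (B * C) x := by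
  simp [rightMul, Matrix.mul_assoc]

theorem rightMul_one [DecidableEq nt] (x : EuclideanSpace ℝ (nt × (nr × Fin 2))) :
    rightMul nr 1 x = x := by
  simp [rightMul]

theorem rightMul_neg (B : Matrix nt nt ℂ) (x : EuclideanSpace ℝ (nt × (nr × Fin 2))) :
    rightMul nr (-B) x = -rightMul nr B x := by
  simp [rightMul]

theorem rightMul_smul (c : ℝ) (B : Matrix nt nt ℂ) (x : EuclideanSpace ℝ (nt × (nr × Fin 2))) :
    rightMul nr ((c : ℂ) • B) x = c • rightMul nr B x := by
  have h : ((c : ℂ) • B) = c • B := by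
    ext i j
    simp
  simp [rightMul, h]

theorem inner_rightMul_left [Fintype nr] (B : Matrix nt nt ℂ)
    (x y : EuclideanSpace ℝ (nt × (nr × Fin 2))) :
    inner ℝ (rightMul nr B x) y = inner ℝ x (rightMul nr Bᴴ y) := by
  obtain ⟨X, rfl⟩ := (vecEquiv nr nt).surjective x
  obtain ⟨Y, rfl⟩ := (vecEquiv nr nt).surjective y
  rw [rightMul_vecEquiv, rightMul_vecEquiv, inner_vecEquiv, inner_vecEquiv, conjTranspose_mul,
    Matrix.mul_assoc, trace_mul_comm, Matrix.mul_assoc]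

/-- `B Cᴴ` is skew-Hermitian, so `x B` and `x C` are orthogonal for every `x`. -/
theorem inner_rightMul_rightMul_eq_zero [Fintype nr] {B C : Matrix nt nt ℂ} (h : B * Cᴴ = -(C * Bᴴ))
    (x : EuclideanSpace ℝ (nt × (nr × Fin 2))) :
    inner ℝ (rightMul nr B x) (rightMul nr C x) = 0 := by
  have h1 : inner ℝ (rightMul nr B x) (rightMul nr C x) =
      inner ℝ x (rightMul nr (C * Bᴴ) x) := by
    rw [inner_rightMul_left, rightMul_rightMul]
  have h2 : inner ℝ (rightMul nr B x) (rightMul nr C x) =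
      -inner ℝ x (rightMul nr (C * Bᴴ) x) := by
    rw [real_inner_comm, inner_rightMul_left, rightMul_rightMul, h, rightMul_neg, inner_neg_right]
  linarith

end RightMultiplication

/-! ### Algebra of the weight matrices -/

section Design

variable {n : ℕ} (ε : ℤˣ)

theorem cuwd_finProdFinEquiv (l : Fin 4) (k : Fin (groupSize (n + 1))) :
    cuwd (n + 1) ε (finProdFinEquiv (l, k)) =
      firstGroup (n + 1) k * groupLeader (n + 1) ε l := by
  rw [cuwd, Equiv.symm_apply_apply]

theorem groupLeader_mul_conjTranspose_self (l : Fin 4) :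
    groupLeader (n + 1) ε l * (groupLeader (n + 1) ε l)ᴴ = 1 := by
  by_cases hl : l = 0
  · rw [hl, groupLeader_zero, conjTranspose_one, mul_one]
  · rw [groupLeader_conjTranspose n ε l hl, mul_neg, groupLeader_mul_self n ε l hl, neg_neg]

theorem groupLeader_mul_conjTranspose {l m : Fin 4} (h : l ≠ m) :
    groupLeader (n + 1) ε l * (groupLeader (n + 1) ε m)ᴴ =
      -(groupLeader (n + 1) ε m * (groupLeader (n + 1) ε l)ᴴ) := by
  by_cases hl : l = 0
  · subst hl
    rw [groupLeader_conjTranspose n ε m h.symm, groupLeader_zero, conjTranspose_one, one_mul,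
      mul_one]
  by_cases hm : m = 0
  · subst hm
    rw [groupLeader_conjTranspose n ε l h, groupLeader_zero, conjTranspose_one, one_mul,
      mul_one, neg_neg]
  rw [groupLeader_conjTranspose n ε l hl, groupLeader_conjTranspose n ε m hm, mul_neg, mul_neg,
    groupLeader_anticomm n ε l m hl hm h, neg_neg]

theorem cuwd_mul_conjTranspose (l m : Fin 4) (k k' : Fin (groupSize (n + 1))) :
    cuwd (n + 1) ε (finProdFinEquiv (l, k)) * (cuwd (n + 1) ε (finProdFinEquiv (m, k')))ᴴ =
      firstGroup (n + 1) k * firstGroup (n + 1) k' *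
        (groupLeader (n + 1) ε l * (groupLeader (n + 1) ε m)ᴴ) := by
  have h1 := (firstGroup_commute_groupLeader n k' ε l).eq
  have h2 : firstGroup (n + 1) k' * (groupLeader (n + 1) ε m)ᴴ =
      (groupLeader (n + 1) ε m)ᴴ * firstGroup (n + 1) k' := by
    have := congrArg conjTranspose (firstGroup_commute_groupLeader n k' ε m).eq
    rw [conjTranspose_mul, conjTranspose_mul, firstGroup_conjTranspose] at this
    exact this.symm
  rw [cuwd_finProdFinEquiv, cuwd_finProdFinEquiv, conjTranspose_mul, firstGroup_conjTranspose,
    ← h2, mul_assoc, mul_assoc, ← mul_assoc (groupLeader (n + 1) ε l), ← h1, mul_assoc]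

/-- Four-group decodability: weight matrices in different groups are Hurwitz-Radon orthogonal. -/
theorem cuwd_mul_conjTranspose_of_ne {l m : Fin 4} (h : l ≠ m) (k k' : Fin (groupSize (n + 1))) :
    cuwd (n + 1) ε (finProdFinEquiv (l, k)) * (cuwd (n + 1) ε (finProdFinEquiv (m, k')))ᴴ =
      -(cuwd (n + 1) ε (finProdFinEquiv (m, k')) *
        (cuwd (n + 1) ε (finProdFinEquiv (l, k)))ᴴ) := by
  rw [cuwd_mul_conjTranspose, cuwd_mul_conjTranspose, groupLeader_mul_conjTranspose ε h, mul_neg,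
    (firstGroup_comm n k k').eq]

theorem cuwd_conjTranspose (i : Fin (4 * groupSize (n + 1))) :
    ∃ c : ℝ, (cuwd (n + 1) ε i)ᴴ = (c : ℂ) • cuwd (n + 1) ε i := by
  obtain ⟨⟨l, k⟩, rfl⟩ := finProdFinEquiv.surjective i
  rw [cuwd_finProdFinEquiv, conjTranspose_mul, firstGroup_conjTranspose,
    (firstGroup_commute_groupLeader n k ε l).eq]
  by_cases hl : l = 0
  · exact ⟨1, by rw [hl, groupLeader_zero, conjTranspose_one, Complex.ofReal_one, one_smul]⟩
  · exact ⟨-1, by simp [groupLeader_conjTranspose n ε l hl]⟩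

theorem groupLeader_mul_mem (l m : Fin 4) :
    ∃ (c : ℝ) (k : Fin (groupSize (n + 1))) (r : Fin 4),
      groupLeader (n + 1) ε l * groupLeader (n + 1) ε m =
        (c : ℂ) • (firstGroup (n + 1) k * groupLeader (n + 1) ε r) := by
  have hpos : 0 < groupSize (n + 1) := by positivity
  by_cases hl : l = 0
  · exact ⟨1, ⟨0, hpos⟩, m, by simp [hl, groupLeader_zero, firstGroup_zero]⟩
  by_cases hm : m = 0
  · exact ⟨1, ⟨0, hpos⟩, l, by simp [hm, groupLeader_zero, firstGroup_zero]⟩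
  by_cases hlm : l = m
  · refine ⟨-1, ⟨0, hpos⟩, 0, ?_⟩
    rw [hlm, groupLeader_mul_self n ε m hm]
    simp [groupLeader_zero, firstGroup_zero]
  have hlast : 2 ^ n - 1 < groupSize (n + 1) := Nat.sub_lt hpos one_pos
  have hcyc : ∀ l m : Fin 4, l ≠ 0 → m ≠ 0 → l ≠ m → ∃ r,
      (l, m, r) ∈ ({(1, 2, 3), (2, 3, 1), (3, 1, 2)} : Finset (Fin 4 × Fin 4 × Fin 4)) ∨
      (m, l, r) ∈ ({(1, 2, 3), (2, 3, 1), (3, 1, 2)} : Finset (Fin 4 × Fin 4 × Fin 4)) := by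
    decide
  obtain ⟨r, h | h⟩ := hcyc l m hl hm hlm
  · refine ⟨((ε : ℤ) : ℝ) * (-1) ^ (n + 1), ⟨_, hlast⟩, r, ?_⟩
    rw [groupLeader_mul n ε l m r h, smul_mul_assoc]
    push_cast
    rfl
  · refine ⟨-(((ε : ℤ) : ℝ) * (-1) ^ (n + 1)), ⟨_, hlast⟩, r, ?_⟩
    rw [groupLeader_anticomm n ε m l hm hl (Ne.symm hlm), groupLeader_mul n ε m l r h,
      smul_mul_assoc]
    push_cast
    rw [neg_smul]

/-- The real span of the weight matrices is closed under multiplication. -/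
theorem cuwd_mul (i j : Fin (4 * groupSize (n + 1))) :
    ∃ (c : ℝ) (t : Fin (4 * groupSize (n + 1))),
      cuwd (n + 1) ε i * cuwd (n + 1) ε j = (c : ℂ) • cuwd (n + 1) ε t := by
  obtain ⟨⟨l, k⟩, rfl⟩ := finProdFinEquiv.surjective i
  obtain ⟨⟨m, k'⟩, rfl⟩ := finProdFinEquiv.surjective j
  obtain ⟨c, u, r, h⟩ := groupLeader_mul_mem (n := n) ε l m
  refine ⟨c, finProdFinEquiv (r, ⟨k ^^^ k' ^^^ u,
    Nat.xor_lt_two_pow (Nat.xor_lt_two_pow k.isLt k'.isLt) u.isLt⟩), ?_⟩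
  simp only [cuwd_finProdFinEquiv]
  rw [mul_assoc, ← mul_assoc (groupLeader (n + 1) ε l),
    ← (firstGroup_commute_groupLeader n k' ε l).eq, mul_assoc, h, ← firstGroup_mul,
    ← firstGroup_mul]
  simp only [mul_smul_comm, mul_assoc]

end Design

/-! ### Orbits of a vector under the weight matrices -/

section Orbit

open InnerProductSpace

variable {nr : Type*} {n : ℕ} (ε : ℤˣ)

/-- The images of `x` under right multiplication by the weight matrices of the CUWD. For `x` the
vectorized channel these are the columns of its equivalent channel matrix. -/
noncomputable def orbit (x : EuclideanSpace ℝ (Antenna (n + 1) × (nr × Fin 2)))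
    (i : Fin (4 * groupSize (n + 1))) : EuclideanSpace ℝ (Antenna (n + 1) × (nr × Fin 2)) :=
  rightMul nr (cuwd (n + 1) ε i) x

/-- The part of the orbit of `x` that belongs to the first group. -/
noncomputable def firstOrbit (x : EuclideanSpace ℝ (Antenna (n + 1) × (nr × Fin 2)))
    (k : Fin (groupSize (n + 1))) : EuclideanSpace ℝ (Antenna (n + 1) × (nr × Fin 2)) :=
  rightMul nr (firstGroup (n + 1) k) x

variable (x y : EuclideanSpace ℝ (Antenna (n + 1) × (nr × Fin 2)))

theorem orbit_finProdFinEquiv (l : Fin 4) (k : Fin (groupSize (n + 1))) :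
    orbit ε x (finProdFinEquiv (l, k)) =
      rightMul nr (groupLeader (n + 1) ε l) (firstOrbit x k) := by
  rw [orbit, cuwd_finProdFinEquiv, firstOrbit, rightMul_rightMul]

theorem orbit_add (i : Fin (4 * groupSize (n + 1))) :
    orbit ε (x + y) i = orbit ε x i + orbit ε y i :=
  map_add _ _ _

/-- The span of an orbit is invariant under the weight matrices, whose span is an algebra. -/
theorem rightMul_mem_span_orbit (i : Fin (4 * groupSize (n + 1)))
    {u : EuclideanSpace ℝ (Antenna (n + 1) × (nr × Fin 2))}
    (hu : u ∈ Submodule.span ℝ (Set.range (orbit ε x))) :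
    orbit ε u i ∈ Submodule.span ℝ (Set.range (orbit ε x)) := by
  rw [orbit]
  induction hu using Submodule.span_induction with
  | mem z hz =>
    obtain ⟨j, rfl⟩ := hz
    obtain ⟨c, t, h⟩ := cuwd_mul ε j i
    rw [orbit, rightMul_rightMul, h, rightMul_smul]
    exact Submodule.smul_mem _ _ (Submodule.subset_span ⟨t, rfl⟩)
  | zero => rw [map_zero]; exact Submodule.zero_mem _
  | add u v _ _ hu hv => rw [map_add]; exact Submodule.add_mem _ hu hv
  | smul c u _ hu => rw [map_smul]; exact Submodule.smul_mem _ _ hu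

theorem mem_span_orbit_self : x ∈ Submodule.span ℝ (Set.range (orbit ε x)) := by
  have hpos : 0 < groupSize (n + 1) := by positivity
  refine Submodule.subset_span ⟨finProdFinEquiv (0, ⟨0, hpos⟩), ?_⟩
  rw [orbit_finProdFinEquiv, groupLeader_zero, rightMul_one, firstOrbit, firstGroup_zero,
    rightMul_one]

theorem finProdFinEquiv_lt_iff {g s : ℕ} (l : Fin g) (k k' : Fin s) :
    finProdFinEquiv (l, k) < finProdFinEquiv (l, k') ↔ k < k' := by
  rw [Fin.lt_def, Fin.lt_def, finProdFinEquiv_apply_val, finProdFinEquiv_apply_val]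
  simp

theorem mul_smul_reversal_apply {s : ℕ} (E : Matrix (Fin s) (Fin s) ℝ) (c : ℝ) (k k' : Fin s) :
    (E * (c • reversal s)) k k' = c * E k k'.rev := by
  rw [mul_apply, Finset.sum_eq_single k'.rev]
  · simp [reversal, mul_comm]
  · intro j _ hj
    have : k' ≠ j.rev := fun h => hj (by rw [h, Fin.rev_rev])
    simp [reversal, this]
  · simp

theorem rightMul_groupLeader_mul_conjTranspose {l m r : Fin 4}
    (h : (l, m, r) ∈ ({(1, 2, 3), (2, 3, 1), (3, 1, 2)} : Finset (Fin 4 × Fin 4 × Fin 4)))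
    (k' : Fin (groupSize (n + 1))) :
    rightMul nr (groupLeader (n + 1) ε l * (groupLeader (n + 1) ε m)ᴴ) (firstOrbit y k') =
      (((ε : ℤ) : ℝ) * (-1) ^ (n + 1)) •
        rightMul nr (groupLeader (n + 1) ε r)ᴴ (firstOrbit y k'.rev) := by
  have hne : ∀ l m r : Fin 4,
      (l, m, r) ∈ ({(1, 2, 3), (2, 3, 1), (3, 1, 2)} : Finset (Fin 4 × Fin 4 × Fin 4)) →
        m ≠ 0 ∧ r ≠ 0 := by
    decide
  obtain ⟨hm, hr⟩ := hne l m r h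
  rw [groupLeader_conjTranspose n ε m hm, groupLeader_conjTranspose n ε r hr, mul_neg,
    groupLeader_mul n ε l m r h, smul_mul_assoc, rightMul_neg, rightMul_neg, smul_neg]
  have hc : (((ε : ℤ) : ℂ) * (-1) ^ (n + 1)) = (((((ε : ℤ) : ℝ) * (-1) ^ (n + 1) : ℝ)) : ℂ) := by
    push_cast
    rfl
  rw [hc, rightMul_smul, firstOrbit, firstOrbit, rightMul_rightMul, rightMul_rightMul,
    ← mul_assoc, firstGroup_last_mul]

variable [Fintype nr]

/-- The orthogonal complement of the span of the orbit of `x` is invariant under the weight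
matrices, since the span is and the adjoint of a weight matrix is a real multiple of it. -/
theorem inner_orbit_eq_zero {u w : EuclideanSpace ℝ (Antenna (n + 1) × (nr × Fin 2))}
    (hu : u ∈ Submodule.span ℝ (Set.range (orbit ε x)))
    (hw : ∀ v ∈ Submodule.span ℝ (Set.range (orbit ε x)), inner ℝ v w = 0)
    (i : Fin (4 * groupSize (n + 1))) : inner ℝ u (orbit ε w i) = 0 := by
  obtain ⟨c, hc⟩ := cuwd_conjTranspose ε i
  rw [real_inner_comm, orbit, inner_rightMul_left, hc, rightMul_smul, real_inner_comm]
  exact hw _ (Submodule.smul_mem _ _ (rightMul_mem_span_orbit ε x i hu))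

theorem inner_orbit_orbit_of_ne {l m : Fin 4} (h : l ≠ m) (k k' : Fin (groupSize (n + 1))) :
    inner ℝ (orbit ε x (finProdFinEquiv (l, k))) (orbit ε x (finProdFinEquiv (m, k'))) = 0 :=
  inner_rightMul_rightMul_eq_zero (cuwd_mul_conjTranspose_of_ne ε h k k') x

theorem inner_rightMul_groupLeader (l : Fin 4) :
    inner ℝ (rightMul nr (groupLeader (n + 1) ε l) x) (rightMul nr (groupLeader (n + 1) ε l) y) =
      inner ℝ x y := by
  rw [inner_rightMul_left, rightMul_rightMul, groupLeader_mul_conjTranspose_self, rightMul_one]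

theorem norm_rightMul_groupLeader (l : Fin 4) :
    ‖rightMul nr (groupLeader (n + 1) ε l) x‖ = ‖x‖ := by
  rw [norm_eq_sqrt_real_inner, inner_rightMul_groupLeader, ← norm_eq_sqrt_real_inner]

theorem inner_rightMul_firstOrbit_of_ne {l m : Fin 4} (h : l ≠ m)
    {u : EuclideanSpace ℝ (Antenna (n + 1) × (nr × Fin 2))}
    (hu : u ∈ Submodule.span ℝ (Set.range (firstOrbit x))) (k' : Fin (groupSize (n + 1))) :
    inner ℝ (rightMul nr (groupLeader (n + 1) ε l) u)
      (orbit ε x (finProdFinEquiv (m, k'))) = 0 := by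
  rw [inner_rightMul_left]
  refine inner_eq_zero_of_mem_span hu ?_
  rintro _ ⟨k, rfl⟩
  rw [← inner_rightMul_left, ← orbit_finProdFinEquiv]
  exact inner_orbit_orbit_of_ne ε x h k k'

/-- The groups are orthogonal, and each is the isometric image of the first under its leader, so
the orthogonalization is carried over from the first group. -/
theorem gramSchmidt_orbit (l : Fin 4) (k : Fin (groupSize (n + 1))) :
    gramSchmidt ℝ (orbit ε x) (finProdFinEquiv (l, k)) =
      rightMul nr (groupLeader (n + 1) ε l) (gramSchmidt ℝ (firstOrbit x) k) := by
  refine gramSchmidt_eq_of_sub_mem_span ?_ fun i hi => ?_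
  · rw [orbit_finProdFinEquiv, ← map_sub]
    have h := Submodule.mem_map_of_mem (f := rightMul nr (groupLeader (n + 1) ε l))
      (sub_gramSchmidt_mem_span (firstOrbit x) k)
    rw [Submodule.map_span] at h
    refine Submodule.span_mono ?_ h
    rintro _ ⟨_, ⟨k', hk', rfl⟩, rfl⟩
    exact ⟨_, (finProdFinEquiv_lt_iff l k' k).mpr hk', orbit_finProdFinEquiv ε x l k'⟩
  · obtain ⟨⟨m, k'⟩, rfl⟩ := finProdFinEquiv.surjective i
    by_cases h : l = m
    · subst h
      rw [orbit_finProdFinEquiv, inner_rightMul_groupLeader]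
      exact inner_gramSchmidt_of_lt _ ((finProdFinEquiv_lt_iff l k' k).mp hi)
    · rw [real_inner_comm]
      exact inner_rightMul_firstOrbit_of_ne ε x h (gramSchmidt_mem_span_range _ k) k'

theorem gramSchmidtNormed_orbit (l : Fin 4) (k : Fin (groupSize (n + 1))) :
    gramSchmidtNormed ℝ (orbit ε x) (finProdFinEquiv (l, k)) =
      rightMul nr (groupLeader (n + 1) ε l) (gramSchmidtNormed ℝ (firstOrbit x) k) := by
  rw [gramSchmidtNormed_eq_smul, gramSchmidtNormed_eq_smul, gramSchmidt_orbit,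
    norm_rightMul_groupLeader, map_smul]

theorem qrFactor_orbit_of_ne {l m : Fin 4} (h : l ≠ m) (k k' : Fin (groupSize (n + 1))) :
    qrFactor (orbit ε x) (finProdFinEquiv (l, k)) (finProdFinEquiv (m, k')) = 0 := by
  have hne : (finProdFinEquiv (l, k) : Fin (4 * groupSize (n + 1))) ≠ finProdFinEquiv (m, k') :=
    fun h' => h (Prod.ext_iff.mp (finProdFinEquiv.injective h')).1
  have h0 := inner_rightMul_firstOrbit_of_ne ε x h
    (gramSchmidtNormed_mem_span_range (firstOrbit x) k) k'
  simp [qrFactor, gramSchmidtNormed_orbit, h0, hne]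

theorem qrFactor_orbit_self (l : Fin 4) (k k' : Fin (groupSize (n + 1))) :
    qrFactor (orbit ε x) (finProdFinEquiv (l, k)) (finProdFinEquiv (l, k')) =
      qrFactor (firstOrbit x) k k' := by
  simp only [qrFactor, of_apply, finProdFinEquiv_lt_iff, gramSchmidtNormed_orbit,
    gramSchmidt_orbit, orbit_finProdFinEquiv, inner_rightMul_groupLeader,
    norm_rightMul_groupLeader, finProdFinEquiv.injective.eq_iff, Prod.mk.injEq, true_and]

theorem qrFactor_orbit_eq_zero (p q : Fin (4 * groupSize (n + 1)))
    (h : p.val / groupSize (n + 1) ≠ q.val / groupSize (n + 1)) :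
    qrFactor (orbit ε x) p q = 0 := by
  have hpos : 0 < groupSize (n + 1) := by positivity
  obtain ⟨⟨l, k⟩, rfl⟩ := finProdFinEquiv.surjective p
  obtain ⟨⟨m, k'⟩, rfl⟩ := finProdFinEquiv.surjective q
  refine qrFactor_orbit_of_ne ε x (fun hlm => h ?_) k k'
  simp only [finProdFinEquiv_apply_val, Nat.add_mul_div_left _ _ hpos, Nat.div_eq_of_lt k.isLt,
    Nat.div_eq_of_lt k'.isLt, hlm]

/-- The inner products of the normalized vectors of the orbit of `x` with the orbit of `y`. -/
noncomputable def crossMatrix :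
    Matrix (Fin (4 * groupSize (n + 1))) (Fin (4 * groupSize (n + 1))) ℝ :=
  Matrix.of fun p j => inner ℝ (gramSchmidtNormed ℝ (orbit ε x) p) (orbit ε y j)

theorem crossMatrix_apply (l m : Fin 4) (k k' : Fin (groupSize (n + 1))) :
    crossMatrix ε x y (finProdFinEquiv (l, k)) (finProdFinEquiv (m, k')) =
      inner ℝ (gramSchmidtNormed ℝ (firstOrbit x) k)
        (rightMul nr (groupLeader (n + 1) ε m * (groupLeader (n + 1) ε l)ᴴ)
          (firstOrbit y k')) := by
  rw [crossMatrix, of_apply, gramSchmidtNormed_orbit, inner_rightMul_left, orbit_finProdFinEquiv,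
    rightMul_rightMul]

/-- The column blocks of the cross matrix in different groups are orthogonal: only the
component of `y` in the span of the orbit of `x` matters, and Parseval's identity turns the
product into inner products of the orbit of that component. -/
theorem crossMatrix_transpose_mul_self {l m : Fin 4} (h : l ≠ m)
    (k k' : Fin (groupSize (n + 1))) :
    ((crossMatrix ε x y)ᵀ * crossMatrix ε x y) (finProdFinEquiv (l, k))
      (finProdFinEquiv (m, k')) = 0 := by
  obtain ⟨u, hu, w, hw, rfl⟩ :=
    (Submodule.span ℝ (Set.range (orbit ε x))).exists_add_mem_mem_orthogonal y
  have hE : ∀ p i, crossMatrix ε x (u + w) p i =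
      inner ℝ (gramSchmidtNormed ℝ (orbit ε x) p) (orbit ε u i) := by
    intro p i
    rw [crossMatrix, of_apply, orbit_add, inner_add_right,
      inner_orbit_eq_zero ε x (gramSchmidtNormed_mem_span_range _ p)
        (fun v hv => (Submodule.mem_orthogonal _ w).mp hw v hv), add_zero]
  simp only [mul_apply, transpose_apply, hE]
  rw [sum_inner_gramSchmidtNormed _ (rightMul_mem_span_orbit ε x _ hu)]
  exact inner_orbit_orbit_of_ne ε u h k k'

/-- The blocks of the cross matrix: the block `(l, m)` depends only on the product of the leader
of group `m` with the inverse leader of group `l`, which is a signed leader, up to `A_λ`. -/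
theorem blocks_crossMatrix :
    ∃ E₁ E₂ E₃ E₄ P : Matrix (Fin (groupSize (n + 1))) (Fin (groupSize (n + 1))) ℝ,
      P = (((ε : ℤ) : ℝ) * (-1) ^ (n + 1)) • reversal (groupSize (n + 1)) ∧
      blocks (crossMatrix ε x y) =
        !![E₁, -E₂, -E₃, -E₄;
           E₂, E₁, -(E₄ * P), E₃ * P;
           E₃, E₄ * P, E₁, -(E₂ * P);
           E₄, -(E₃ * P), E₂ * P, E₁] := by
  have hdiag : ∀ l, blocks (crossMatrix ε x y) l l = blocks (crossMatrix ε x y) 0 0 := by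
    intro l
    ext k k'
    simp only [blocks, of_apply, submatrix_apply, crossMatrix_apply,
      groupLeader_mul_conjTranspose_self]
  have hrow : ∀ m, m ≠ 0 → blocks (crossMatrix ε x y) 0 m = -blocks (crossMatrix ε x y) m 0 := by
    intro m hm
    ext k k'
    simp only [blocks, of_apply, submatrix_apply, crossMatrix_apply, Matrix.neg_apply]
    rw [groupLeader_mul_conjTranspose ε hm, rightMul_neg, inner_neg_right]
  have hcyc : ∀ l m r : Fin 4,
      (l, m, r) ∈ ({(1, 2, 3), (2, 3, 1), (3, 1, 2)} : Finset (Fin 4 × Fin 4 × Fin 4)) →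
      blocks (crossMatrix ε x y) m l = blocks (crossMatrix ε x y) r 0 *
        ((((ε : ℤ) : ℝ) * (-1) ^ (n + 1)) • reversal (groupSize (n + 1))) := by
    intro l m r h
    ext k k'
    rw [mul_smul_reversal_apply]
    simp only [blocks, of_apply, submatrix_apply, crossMatrix_apply]
    rw [rightMul_groupLeader_mul_conjTranspose ε y h, real_inner_smul_right, groupLeader_zero,
      one_mul]
  have hcyc' : ∀ l m r : Fin 4, l ≠ m →
      (l, m, r) ∈ ({(1, 2, 3), (2, 3, 1), (3, 1, 2)} : Finset (Fin 4 × Fin 4 × Fin 4)) →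
      blocks (crossMatrix ε x y) l m = -(blocks (crossMatrix ε x y) r 0 *
        ((((ε : ℤ) : ℝ) * (-1) ^ (n + 1)) • reversal (groupSize (n + 1)))) := by
    intro l m r hlm h
    rw [← hcyc l m r h]
    ext k k'
    simp only [blocks, of_apply, submatrix_apply, crossMatrix_apply, Matrix.neg_apply]
    rw [groupLeader_mul_conjTranspose ε hlm.symm, rightMul_neg, inner_neg_right]
  generalize blocks (crossMatrix ε x y) = B at hdiag hrow hcyc hcyc' ⊢
  refine ⟨B 0 0, B 1 0, B 2 0, B 3 0, _, rfl, ?_⟩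
  generalize (((ε : ℤ) : ℝ) * (-1) ^ (n + 1)) • reversal (groupSize (n + 1)) = P at hcyc hcyc' ⊢
  rw [← hrow 1 (by decide), ← hrow 2 (by decide), ← hrow 3 (by decide),
    ← hcyc' 1 2 3 (by decide) (by decide), ← hcyc' 2 3 1 (by decide) (by decide),
    ← hcyc' 3 1 2 (by decide) (by decide), ← hcyc 1 2 3 (by decide), ← hcyc 2 3 1 (by decide),
    ← hcyc 3 1 2 (by decide)]
  ext1 l m
  fin_cases l <;> fin_cases m
  all_goals first | rfl | exact hdiag _

end Orbit

/-! ### The two halves of the equivalent channel -/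

section ConstructionOne

open InnerProductSpace

variable {n nr : ℕ} (ε : ℤˣ) (M : Matrix (Antenna (n + 1)) (Antenna (n + 1)) ℂ)
  (H : Matrix (Fin nr) (Antenna (n + 1)) ℂ)

theorem channelColumn_castAdd (i : Fin (4 * groupSize (n + 1))) :
    channelColumn H (constructionI (cuwd (n + 1) ε) M) (Fin.castAdd _ i) =
      orbit ε (vecEquiv _ _ H) i := by
  rw [channelColumn_eq_vecEquiv, constructionI, Fin.append_left, orbit, rightMul_vecEquiv]

theorem channelColumn_natAdd (i : Fin (4 * groupSize (n + 1))) :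
    channelColumn H (constructionI (cuwd (n + 1) ε) M) (Fin.natAdd _ i) =
      orbit ε (vecEquiv _ _ (H * M)) i := by
  rw [channelColumn_eq_vecEquiv, constructionI, Fin.append_right, orbit, rightMul_vecEquiv,
    Matrix.mul_assoc]

theorem rConstructionI_castAdd_castAdd (i j : Fin (4 * groupSize (n + 1))) :
    rConstructionI (n + 1) ε M H (Fin.castAdd _ i) (Fin.castAdd _ j) =
      qrFactor (orbit ε (vecEquiv _ _ H)) i j := by
  change qrFactor _ _ _ = _
  rw [qrFactor_castAdd_castAdd, funext (channelColumn_castAdd ε M H)]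

theorem blockE_rConstructionI :
    blockE (rConstructionI (n + 1) ε M H) =
      crossMatrix ε (vecEquiv _ _ H) (vecEquiv _ _ (H * M)) := by
  ext i j
  change qrFactor _ _ _ = _
  rw [qrFactor_castAdd_natAdd, funext (channelColumn_castAdd ε M H), channelColumn_natAdd]
  rfl

/-- The component of `H M` orthogonal to the span of the first half of the columns generates the
second half after the first has been projected out, so `R₂` is the triangular factor of an orbit
as well. -/
theorem exists_rConstructionI_natAdd_natAdd :
    ∃ w : EuclideanSpace ℝ (Antenna (n + 1) × (Fin nr × Fin 2)),
      ∀ i j, rConstructionI (n + 1) ε M H (Fin.natAdd _ i) (Fin.natAdd _ j) =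
      qrFactor (orbit ε w) i j := by
  obtain ⟨u, hu, w, hw, huw⟩ :=
    (Submodule.span ℝ (Set.range (orbit ε (vecEquiv _ _ H)))).exists_add_mem_mem_orthogonal
      (vecEquiv _ _ (H * M))
  refine ⟨w, qrFactor_natAdd_natAdd _ _ (fun j => ?_) fun i j => ?_⟩
  · rw [channelColumn_natAdd, huw, orbit_add, add_sub_cancel_right,
      funext (channelColumn_castAdd ε M H)]
    exact rightMul_mem_span_orbit ε _ j hu
  · rw [channelColumn_castAdd]
    exact inner_orbit_eq_zero ε _ (Submodule.subset_span ⟨i, rfl⟩)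
      (fun v hv => (Submodule.mem_orthogonal _ w).mp hw v hv) j

theorem hasBlockOrthogonalPattern_rConstructionI :
    HasBlockOrthogonalPattern 2 4 (groupSize (n + 1)) (rConstructionI (n + 1) ε M H) where
  size_eq := by ring
  upper p q h := by
    rw [rConstructionI, rMatrix, of_apply, if_neg h.asymm, if_neg h.ne']
  blockDiag p q h1 h2 := by
    have hpos : 0 < groupSize (n + 1) := by positivity
    have hdiv : ∀ i : Fin (4 * groupSize (n + 1)),
        i.val / (4 * groupSize (n + 1)) = 0 := fun i => Nat.div_eq_of_lt i.isLt
    have hdiv' : ∀ i : Fin (4 * groupSize (n + 1)),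
        (4 * groupSize (n + 1) + i.val) / groupSize (n + 1) = 4 + i.val / groupSize (n + 1) := by
      intro i
      rw [add_comm, Nat.add_mul_div_right _ _ hpos, add_comm]
    have hpos' : 0 < 4 * groupSize (n + 1) := by positivity
    induction p using Fin.addCases with
    | left p =>
      induction q using Fin.addCases with
      | left q =>
        rw [rConstructionI_castAdd_castAdd]
        exact qrFactor_orbit_eq_zero ε _ p q h2
      | right q =>
        rw [Fin.val_castAdd, Fin.val_natAdd, Nat.add_div_left _ hpos', hdiv, hdiv] at h1
        omega
    | right p =>
      induction q using Fin.addCases with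
      | left q =>
        rw [Fin.val_castAdd, Fin.val_natAdd, Nat.add_div_left _ hpos', hdiv, hdiv] at h1
        omega
      | right q =>
        obtain ⟨w, hw⟩ := exists_rConstructionI_natAdd_natAdd ε M H
        rw [hw]
        refine qrFactor_orbit_eq_zero ε w p q fun h => h2 ?_
        rw [Fin.val_natAdd, Fin.val_natAdd, hdiv', hdiv', h]

theorem qrFactor_col_eq_zero {E ι : Type*} [NormedAddCommGroup E] [InnerProductSpace ℝ E]
    [LinearOrder ι] [LocallyFiniteOrderBot ι] [WellFoundedLT ι] {f : ι → E} {j : ι}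
    (hj : f j = 0) (i : ι) : qrFactor f i j = 0 := by
  have h0 : gramSchmidt ℝ f j = 0 :=
    gramSchmidt_eq_of_sub_mem_span (by rw [hj, sub_zero]; exact Submodule.zero_mem _)
      fun _ _ => inner_zero_right _
  rw [qrFactor, of_apply]
  split_ifs with h1 h2
  · rw [hj, inner_zero_right]
  · rw [h2, h0, norm_zero]
  · rfl

theorem rank_ne_card_of_col_eq_zero {ι : Type*} [Fintype ι] [DecidableEq ι] {R : Matrix ι ι ℝ}
    {j : ι} (hj : ∀ i, R i j = 0) : R.rank ≠ Fintype.card ι := by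
  intro h
  have htop : LinearMap.range R.mulVecLin = ⊤ :=
    Submodule.eq_top_of_finrank_eq (by rw [Module.finrank_fintype_fun_eq_card]; exact h)
  have hinj := LinearMap.injective_iff_surjective.mpr (LinearMap.range_eq_top.mp htop)
  have h0 : R.mulVecLin (Pi.single j 1) = R.mulVecLin 0 := by
    ext i
    simp [hj]
  simpa using congrFun (hinj h0) j

/-- If `H M = 0`, the second half of the columns vanishes and the rank drops. -/
theorem mul_ne_zero_of_rank_rConstructionI
    (h : (rConstructionI (n + 1) ε M H).rank = 8 * groupSize (n + 1)) : H * M ≠ 0 := by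
  intro h0
  have hpos : 0 < 4 * groupSize (n + 1) := by positivity
  refine rank_ne_card_of_col_eq_zero (R := rConstructionI (n + 1) ε M H)
    (j := Fin.natAdd _ ⟨0, hpos⟩) (fun i => qrFactor_col_eq_zero ?_ i) ?_
  · rw [channelColumn_natAdd, h0, map_zero, orbit, map_zero]
  · rw [h, Fintype.card_fin]
    ring

/-- If the real inner products of all `H` with all `H M A_j` vanish, every `M A_j` acts as a
skew-Hermitian matrix. Then `M` commutes with `A_λ` and anticommutes with the three leaders, whose
product is `A_λ` up to sign; so `M` annihilates every `H`. -/
theorem mul_eq_zero_of_inner_eq_zero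
    (h : ∀ (H : Matrix (Fin nr) (Antenna (n + 1)) ℂ) (j : Fin (4 * groupSize (n + 1))),
      inner ℝ (vecEquiv _ _ H) (vecEquiv _ _ (H * (M * cuwd (n + 1) ε j))) = 0) :
    H * M = 0 := by
  have hpos : 0 < groupSize (n + 1) := by positivity
  have hlast : 2 ^ n - 1 < groupSize (n + 1) := Nat.sub_lt hpos one_pos
  have hskew : ∀ (X : Matrix (Fin nr) (Antenna (n + 1)) ℂ) j,
      X * (M * cuwd (n + 1) ε j) = -(X * ((cuwd (n + 1) ε j)ᴴ * Mᴴ)) := by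
    intro X j
    rw [eq_neg_iff_add_eq_zero, ← (vecEquiv _ _).map_eq_zero_iff, ← inner_self_eq_zero (𝕜 := ℝ)]
    -- Polarization: test the quadratic form at `Y + X`, with `Y` the vector to be shown zero.
    generalize hY : X * (M * cuwd (n + 1) ε j) + X * ((cuwd (n + 1) ε j)ᴴ * Mᴴ) = Y
    have h1 := h (Y + X) j
    rw [Matrix.add_mul, map_add, map_add, inner_add_left, inner_add_right, inner_add_right, h Y,
      h X, zero_add, add_zero] at h1
    have h2 := inner_rightMul_left (M * cuwd (n + 1) ε j)ᴴ (vecEquiv _ _ X) (vecEquiv _ _ Y)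
    rw [conjTranspose_conjTranspose, rightMul_vecEquiv, rightMul_vecEquiv, conjTranspose_mul] at h2
    nth_rw 1 [← hY]
    rw [map_add, inner_add_left, h2, real_inner_comm, h1]
  have hself : ∀ X : Matrix (Fin nr) (Antenna (n + 1)) ℂ, X * Mᴴ = -(X * M) := by
    intro X
    have := hskew X (finProdFinEquiv (0, ⟨0, hpos⟩))
    rw [cuwd_finProdFinEquiv, firstGroup_zero, groupLeader_zero, mul_one, mul_one,
      conjTranspose_one, one_mul] at this
    rw [this, neg_neg]
  have hmove : ∀ (X : Matrix (Fin nr) (Antenna (n + 1)) ℂ) j,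
      X * M * cuwd (n + 1) ε j = X * (cuwd (n + 1) ε j)ᴴ * M := by
    intro X j
    rw [Matrix.mul_assoc, hskew, ← Matrix.mul_assoc, hself, neg_neg]
  have hleader : ∀ (X : Matrix (Fin nr) (Antenna (n + 1)) ℂ) (l : Fin 4), l ≠ 0 →
      X * M * groupLeader (n + 1) ε l = -(X * groupLeader (n + 1) ε l * M) := by
    intro X l hl
    have := hmove X (finProdFinEquiv (l, ⟨0, hpos⟩))
    rw [cuwd_finProdFinEquiv, firstGroup_zero, one_mul,
      groupLeader_conjTranspose n ε l hl, Matrix.mul_neg, Matrix.neg_mul] at this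
    exact this
  have hD : H * M * firstGroup (n + 1) (2 ^ n - 1) = H * firstGroup (n + 1) (2 ^ n - 1) * M := by
    have := hmove H (finProdFinEquiv (0, ⟨_, hlast⟩))
    rw [cuwd_finProdFinEquiv, groupLeader_zero, mul_one, firstGroup_conjTranspose] at this
    exact this
  -- The product of the three leaders is a nonzero multiple of `A_λ`.
  have hprod : groupLeader (n + 1) ε 1 * groupLeader (n + 1) ε 2 * groupLeader (n + 1) ε 3 =
      (-(((ε : ℤ) : ℂ) * (-1) ^ (n + 1))) • firstGroup (n + 1) (2 ^ n - 1) := by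
    rw [groupLeader_mul n ε 1 2 3 (by decide), mul_assoc, groupLeader_mul_self n ε 3 (by decide),
      mul_neg, mul_one, neg_smul]
  have hc : (-(((ε : ℤ) : ℂ) * (-1) ^ (n + 1))) ≠ 0 := by
    simp
  have h3 : H * M * (groupLeader (n + 1) ε 1 * groupLeader (n + 1) ε 2 * groupLeader (n + 1) ε 3) =
      -(H * (groupLeader (n + 1) ε 1 * groupLeader (n + 1) ε 2 * groupLeader (n + 1) ε 3) * M) := by
    simp only [← Matrix.mul_assoc]
    rw [hleader H 1 (by decide), Matrix.neg_mul, Matrix.neg_mul, hleader _ 2 (by decide),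
      Matrix.neg_mul, neg_neg, hleader _ 3 (by decide)]
  rw [hprod, Matrix.mul_smul, Matrix.mul_smul, Matrix.smul_mul, ← smul_neg] at h3
  have h4 := smul_right_injective _ hc h3
  rw [← hD] at h4
  have h5 : H * M * firstGroup (n + 1) (2 ^ n - 1) = 0 := by
    ext i k
    exact self_eq_neg.mp (congrFun (congrFun h4 i) k)
  have h6 := congrArg (· * firstGroup (n + 1) (2 ^ n - 1)) h5
  simpa only [Matrix.mul_assoc, firstGroup_mul_self, Matrix.mul_one, Matrix.zero_mul] using h6

theorem isBlockOrthogonal_rConstructionI {j : Fin (4 * groupSize (n + 1))}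
    (h : inner ℝ (vecEquiv _ _ H) (vecEquiv _ _ (H * (M * cuwd (n + 1) ε j))) ≠ 0) :
    IsBlockOrthogonal 2 4 (groupSize (n + 1)) (rConstructionI (n + 1) ε M H) where
  toHasBlockOrthogonalPattern := hasBlockOrthogonalPattern_rConstructionI ε M H
  offDiag_ne_zero i k hik hk := by
    obtain ⟨rfl, rfl⟩ : i = 0 ∧ k = 1 := by omega
    have hpos : 0 < 4 * groupSize (n + 1) := by positivity
    rw [← Matrix.mul_assoc, ← rightMul_vecEquiv,
      ← sum_inner_gramSchmidtNormed _ (mem_span_orbit_self ε (vecEquiv _ _ H))] at h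
    obtain ⟨p, -, hp⟩ := Finset.exists_ne_zero_of_sum_ne_zero h
    refine ⟨Fin.castAdd _ p, Fin.natAdd _ j, ?_, ?_, ?_⟩
    · exact Nat.div_eq_of_lt p.isLt
    · rw [Fin.val_natAdd, Nat.add_div_left _ hpos, Nat.div_eq_of_lt j.isLt]
    · have := congrFun (congrFun (blockE_rConstructionI ε M H) p) j
      change rConstructionI (n + 1) ε M H (Fin.castAdd _ p) (Fin.natAdd _ j) = _ at this
      rw [this]
      exact right_ne_zero_of_mul hp

end ConstructionOne

/-! ### Null sets of quadratic forms -/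

section AlmostEverywhere

open MeasureTheory

/-- A quadratic form that does not vanish identically vanishes only on a null set: along a
direction in which it does not vanish, it restricts to a quadratic polynomial on every line. -/
theorem ae_inner_map_map_ne_zero {V E : Type*} [NormedAddCommGroup V] [NormedSpace ℝ V]
    [FiniteDimensional ℝ V] [MeasurableSpace V] [BorelSpace V] (μ : Measure V)
    [μ.IsAddHaarMeasure] [NormedAddCommGroup E] [InnerProductSpace ℝ E] (S T : V →ₗ[ℝ] E)
    {v : V} (hv : inner ℝ (S v) (T v) ≠ 0) : ∀ᵐ x ∂μ, inner ℝ (S x) (T x) ≠ 0 := by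
  have hcont : Continuous fun x => inner ℝ (S x) (T x) :=
    S.continuous_of_finiteDimensional.inner T.continuous_of_finiteDimensional
  refine ae_mem_of_ae_add_linearMap_mem (LinearMap.toSpanSingleton ℝ V v) volume μ
    (s := {x | inner ℝ (S x) (T x) ≠ 0}) (isOpen_ne_fun hcont continuous_const).measurableSet
    fun y => ?_
  let p : Polynomial ℝ := Polynomial.C (inner ℝ (S v) (T v)) * Polynomial.X ^ 2 +
    Polynomial.C (inner ℝ (S y) (T v) + inner ℝ (S v) (T y)) * Polynomial.X +
    Polynomial.C (inner ℝ (S y) (T y))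
  have hp : p ≠ 0 := by
    intro h0
    have h2 := congrArg (fun q => Polynomial.coeff q 2) h0
    simp only [p, Polynomial.coeff_add, Polynomial.coeff_C_mul, Polynomial.coeff_X_pow,
      Polynomial.coeff_X, Polynomial.coeff_C, Polynomial.coeff_zero] at h2
    exact hv (by simpa using h2)
  have hnull := (Polynomial.finite_setOfPred_isRoot hp).measure_zero volume
  filter_upwards [compl_mem_ae_iff.mpr hnull] with t ht
  intro h0
  refine ht ?_
  simp only [LinearMap.toSpanSingleton_apply, map_add, map_smul, inner_add_left, inner_add_right,
    real_inner_smul_left, real_inner_smul_right] at h0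
  simp only [Set.mem_ofPred_eq, Polynomial.IsRoot, p, Polynomial.eval_add, Polynomial.eval_mul,
    Polynomial.eval_C, Polynomial.eval_pow, Polynomial.eval_X]
  linarith

end AlmostEverywhere

end STBC

theorem lemma5 (a : ℕ) (ha : 1 ≤ a) (ε : ℤˣ) (nr : ℕ)
    (M : Matrix (STBC.Antenna a) (STBC.Antenna a) ℂ) :
    (∀ H : Matrix (Fin nr) (STBC.Antenna a) ℂ,
      (STBC.rConstructionI a ε M H).rank = 8 * STBC.groupSize a →
        STBC.HasBlockOrthogonalPattern 2 4 (STBC.groupSize a) (STBC.rConstructionI a ε M H) ∧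
        (∀ i : Fin 4,
          STBC.blocks (STBC.blockR1 (STBC.rConstructionI a ε M H)) i i =
            STBC.blocks (STBC.blockR1 (STBC.rConstructionI a ε M H)) 0 0) ∧
        (∃ E₁ E₂ E₃ E₄ P : Matrix (Fin (STBC.groupSize a)) (Fin (STBC.groupSize a)) ℝ,
          P = (((ε : ℤ) : ℝ) * (-1) ^ a) • STBC.reversal (STBC.groupSize a) ∧
          STBC.blocks (STBC.blockE (STBC.rConstructionI a ε M H)) =
            !![E₁, -E₂, -E₃, -E₄;
               E₂, E₁, -(E₄ * P), E₃ * P;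
               E₃, E₄ * P, E₁, -(E₂ * P);
               E₄, -(E₃ * P), E₂ * P, E₁]) ∧
        (∀ i j : Fin 4, i ≠ j →
          STBC.blocks ((STBC.blockE (STBC.rConstructionI a ε M H))ᵀ *
            STBC.blockE (STBC.rConstructionI a ε M H)) i j = 0)) ∧
    (∀ᵐ H : Fin nr → STBC.Antenna a → ℂ,
      (STBC.rConstructionI a ε M (Matrix.of H)).rank = 8 * STBC.groupSize a →
        STBC.IsBlockOrthogonal 2 4 (STBC.groupSize a)
          (STBC.rConstructionI a ε M (Matrix.of H))) := by
  obtain ⟨n, rfl⟩ : ∃ n, a = n + 1 := ⟨a - 1, by omega⟩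
  refine ⟨fun H _ => ⟨STBC.hasBlockOrthogonalPattern_rConstructionI ε M H, fun i => ?_, ?_, ?_⟩,
    ?_⟩
  · ext k k'
    simp only [STBC.blocks, STBC.blockR1, of_apply, submatrix_apply,
      STBC.rConstructionI_castAdd_castAdd, STBC.qrFactor_orbit_self]
  · rw [STBC.blockE_rConstructionI]
    exact STBC.blocks_crossMatrix ε _ _
  · intro i j hij
    ext k k'
    rw [STBC.blockE_rConstructionI]
    exact STBC.crossMatrix_transpose_mul_self ε _ _ hij k k'
  · by_cases h : ∀ (H : Matrix (Fin nr) (STBC.Antenna (n + 1)) ℂ)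
        (j : Fin (4 * STBC.groupSize (n + 1))),
        inner ℝ (STBC.vecEquiv _ _ H)
          (STBC.vecEquiv _ _ (H * (M * STBC.cuwd (n + 1) ε j))) = 0
    -- Here the second half of the columns vanishes, so `R` never has full rank.
    · refine Filter.Eventually.of_forall fun H hH => ?_
      exact absurd (STBC.mul_eq_zero_of_inner_eq_zero ε M (Matrix.of H) h)
        (STBC.mul_ne_zero_of_rank_rConstructionI ε M _ hH)
    · push Not at h
      obtain ⟨H₀, j, hj⟩ := h
      let S : (Fin nr → STBC.Antenna (n + 1) → ℂ) →ₗ[ℝ] _ :=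
        (STBC.vecEquiv (Fin nr) (STBC.Antenna (n + 1))).toLinearMap ∘ₗ
          (Matrix.ofLinearEquiv ℝ).toLinearMap
      have : (MeasureTheory.volume :
          MeasureTheory.Measure (STBC.Antenna (n + 1) → ℂ)).IsAddHaarMeasure :=
        MeasureTheory.Measure.pi.isAddHaarMeasure _
      have : (MeasureTheory.volume :
          MeasureTheory.Measure (Fin nr → STBC.Antenna (n + 1) → ℂ)).IsAddHaarMeasure :=
        MeasureTheory.Measure.pi.isAddHaarMeasure _
      have hae := STBC.ae_inner_map_map_ne_zero MeasureTheory.volume S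
        (STBC.rightMul _ (M * STBC.cuwd (n + 1) ε j) ∘ₗ S) (v := Matrix.of.symm H₀) (by
          rw [LinearMap.comp_apply]
          change inner ℝ (STBC.vecEquiv _ _ H₀) (STBC.rightMul _ _ (STBC.vecEquiv _ _ H₀)) ≠ 0
          rwa [STBC.rightMul_vecEquiv])
      filter_upwards [hae] with H hH _
      refine STBC.isBlockOrthogonal_rConstructionI ε M (Matrix.of H) (j := j) ?_
      rw [← STBC.rightMul_vecEquiv]
      exact hH
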